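/- Let $N\ge 1$, $s>0$, $\lambda_L,\lambda_R>0$, and put $T_L=1/\lambda_L$, $T_R=1/\lambda_R$. Consider the Markov process $(y(t))_{t\ge0}$ on $(0,\infty)^N$ with generator $\mathscr L=\mathscr L_1+\sum_{i=1}^{N-1}\mathscr L_{i,i+1}+\mathscr L_N$ acting on polynomial functions $f$, where, with $\delta_i$ the $i$-th unit vector, $$\mathscr L_{i,i+1}f(y)=\int_0^{y_i}\frac{d\alpha}{\alpha}\Bigl(1-\frac{\alpha}{y_i}\Bigr)^{2s-1}\bigl[f(y-\alpha\delta_i+\alpha\delta_{i+1})-f(y)\bigr]+\int_0^{y_{i+1}}\frac{d\alpha}{\alpha}\Bigl(1-\frac{\alpha}{y_{i+1}}\Bigr)^{2s-1}\bigl[f(y+\alpha\delta_i-\alpha\delta_{i+1})-f(y)\bigr],$$ $$\mathscr L_{1}f(y)=\int_0^{y_1}\frac{d\alpha}{\alpha}\Bigl(1-\frac{\alpha}{y_1}\Bigr)^{2s-1}\bigl[f(y-\alpha\delta_1)-f(y)\bigr]+\int_0^{\infty}\frac{d\alpha}{\alpha}e^{-\lambda_L\alpha}\bigl[f(y+\alpha\delta_1)-f(y)\bigr],$$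 $$\mathscr L_{N}f(y)=\int_0^{y_N}\frac{d\alpha}{\alpha}\Bigl(1-\frac{\alpha}{y_N}\Bigr)^{2s-1}\bigl[f(y-\alpha\delta_N)-f(y)\bigr]+\int_0^{\infty}\frac{d\alpha}{\alpha}e^{-\lambda_R\alpha}\bigl[f(y+\alpha\delta_N)-f(y)\bigr].$$ That is, for every polynomial $f$ the expectations $P_tf(y)=\mathbb E_y[f(y(t))]$ are finite and $\frac{d}{dt}P_tf=P_t\mathscr Lf$ for all $t\ge 0$. Let $\mu_N$ be a stationary probability measure of this process on $(0,\infty)^N$, and let $\xi=(\xi_1,\dots,\xi_N)\in\mathbb N_0^N$, $|\xi|=\sum_{i=1}^N\xi_i$. (i) The multivariate moments of $\mu_N$ are finite and $$\int_{(0,\infty)^N}\prod_{i=1}^N y_i^{\xi_i}\frac{\Gamma(2s)}{\Gamma(2s+\xi_i)}\,\mu_N(dy)=\sum_{n=0}^{|\xi|}T_R^{|\xi|-n}(T_L-T_R)^n\,g_\xi(n),$$ where $$g_\xi(n)=\sum_{\substack{(n_1,\dots,n_N)\in\mathbb N_0^N\\ n_1+\dots+n_N=n}}\ \prod_{i=1}^N\binom{\xi_i}{n_i}\prod_{j=1}^{n_i}\frac{2s(N+1-i)-j+\sum_{k=i}^Nn_k}{2s(N+1)-j+\sum_{k=i}^Nn_k}.$$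 (ii) Equivalently, if $x_1\le x_2\le\dots\le x_{|\xi|}$ are the ordered positions of the particles of the configuration $\xi$ (each site $i\in\{1,\dots,N\}$ occurs exactly $\xi_i$ times among the $x_k$), then $$\int_{(0,\infty)^N}\prod_{i=1}^N y_i^{\xi_i}\frac{\Gamma(2s)}{\Gamma(2s+\xi_i)}\,\mu_N(dy)=\sum_{n=0}^{|\xi|}T_R^{|\xi|-n}(T_L-T_R)^n\,g_x(n),$$ where $$g_x(n)=\sum_{1\le i_1<\dots<i_n\le|\xi|}\ \prod_{\alpha=1}^n\frac{n-\alpha+2s(N+1-x_{i_\alpha})}{n-\alpha+2s(N+1)},$$ and $g_x(n)=g_\xi(n)$ for every $n\ge 0$. -/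

import Mathlib

open MeasureTheory ProbabilityTheory
open scoped NNReal

noncomputable section

namespace HeatConduction

/-- The state space `(0, ∞)^N`: energy configurations of a chain of `N` sites. Site `i` of the
usual numbering `1, …, N` is the element of `Fin N` with value `i - 1`. -/
abbrev State (N : ℕ) : Type := {y : Fin N → ℝ // ∀ i, 0 < y i}

/-- Energy `α ∈ (0, y i)` jumps from site `i` to site `j` with intensity
`α⁻¹ (1 - α / y i) ^ (2 s - 1) dα`. -/
def transferGen {N : ℕ} (s : ℝ) (i j : Fin N) (f : (Fin N → ℝ) → ℝ) (y : Fin N → ℝ) : ℝ :=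
  ∫ α in (0 : ℝ)..(y i), (1 / α) * (1 - α / y i) ^ (2 * s - 1) *
    (f (y - Pi.single i α + Pi.single j α) - f y)

/-- The generator on the bond `(i, j)`: energy moves from `i` to `j` and from `j` to `i`. -/
def bondGen {N : ℕ} (s : ℝ) (i j : Fin N) (f : (Fin N → ℝ) → ℝ) (y : Fin N → ℝ) : ℝ :=
  transferGen s i j f y + transferGen s j i f y

/-- A reservoir with parameter `lam` attached to site `i`: it removes energy `α ∈ (0, y i)` with
intensity `α⁻¹ (1 - α / y i) ^ (2 s - 1) dα` and injects energy `α ∈ (0, ∞)` with intensity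
`α⁻¹ exp (-lam α) dα`. -/
def reservoirGen {N : ℕ} (s lam : ℝ) (i : Fin N) (f : (Fin N → ℝ) → ℝ) (y : Fin N → ℝ) : ℝ :=
  (∫ α in (0 : ℝ)..(y i), (1 / α) * (1 - α / y i) ^ (2 * s - 1) *
    (f (y - Pi.single i α) - f y)) +
  ∫ α in Set.Ioi (0 : ℝ), (1 / α) * Real.exp (-lam * α) * (f (y + Pi.single i α) - f y)

/-- The full generator: reservoirs at the first and the last site, and all nearest-neighbour
bonds. -/
def generator {N : ℕ} [NeZero N] (s lamL lamR : ℝ) (f : (Fin N → ℝ) → ℝ) (y : Fin N → ℝ) : ℝ :=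
  reservoirGen s lamL 0 f y +
  (∑ i : Fin N, if h : i.val + 1 < N then bondGen s i ⟨i.val + 1, h⟩ f y else 0) +
  reservoirGen s lamR ⊤ f y

/-- `P` is the transition semigroup of a (time-homogeneous) Markov process on `(0, ∞)^N` generated
by `generator s lamL lamR` acting on polynomial functions: `P t` are Markov kernels satisfying the
Chapman-Kolmogorov equations, polynomials `p` have finite expectations
`(P t p) (y) = E_y [p (y(t))]`, and `d/dt P t p = P t (L p)` for all `t ≥ 0` (one-sided at
`t = 0`). -/
structure IsProcessSemigroup {N : ℕ} [NeZero N] (s lamL lamR : ℝ)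
    (P : ℝ≥0 → Kernel (State N) (State N)) : Prop where
  markov : ∀ t, IsMarkovKernel (P t)
  zero : P 0 = Kernel.id
  add : ∀ t u, P (t + u) = P t ∘ₖ P u
  integrable : ∀ (p : MvPolynomial (Fin N) ℝ) (t : ℝ≥0) (y : State N),
    Integrable (fun z : State N => MvPolynomial.eval z.1 p) (P t y)
  hasDeriv : ∀ (p : MvPolynomial (Fin N) ℝ) (t : ℝ≥0) (y : State N),
    HasDerivWithinAt
      (fun r : ℝ => ∫ z : State N, MvPolynomial.eval z.1 p ∂(P r.toNNReal y))
      (∫ z : State N, generator s lamL lamR (fun w => MvPolynomial.eval w p) z.1 ∂(P t y))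
      (Set.Ici 0) (t : ℝ)

/-- `μ` is a stationary (invariant) probability measure of the process with semigroup `P`:
if `y(0) ∼ μ` then `y(t) ∼ μ` for all `t`. -/
structure IsStationary {N : ℕ} (P : ℝ≥0 → Kernel (State N) (State N))
    (μ : Measure (State N)) : Prop where
  isProbabilityMeasure : IsProbabilityMeasure μ
  invariant : ∀ t, Kernel.Invariant (P t) μ

/-- The normalized monomial `∏ i, y_i ^ ξ_i * Γ(2s) / Γ(2s + ξ_i)`. -/
def normMonomial {N : ℕ} (s : ℝ) (ξ : Fin N → ℕ) (y : Fin N → ℝ) : ℝ :=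
  ∏ i, y i ^ ξ i * (Real.Gamma (2 * s) / Real.Gamma (2 * s + ξ i))

/-- `g_ξ(n)`, in terms of occupation numbers. The outer sum is over all `m : Fin N → ℕ` with
`∑ i, m i = n`; with sites numbered from `0`, the usual `N + 1 - i` reads `N - i`. -/
def gOcc {N : ℕ} (s : ℝ) (ξ : Fin N → ℕ) (n : ℕ) : ℝ :=
  ∑ m ∈ Finset.piAntidiag (Finset.univ : Finset (Fin N)) n,
    ∏ i : Fin N, ((ξ i).choose (m i) : ℝ) * ∏ j ∈ Finset.Icc 1 (m i),
      (2 * s * ((N : ℝ) - (i.val : ℝ)) - (j : ℝ) + ∑ k ∈ Finset.Ici i, (m k : ℝ)) /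
      (2 * s * ((N : ℝ) + 1) - (j : ℝ) + ∑ k ∈ Finset.Ici i, (m k : ℝ))

open Classical in
/-- `g_x(n)`, in terms of the positions `x` of `M` particles. The sum is over the strictly
increasing index tuples `e 0 < ⋯ < e (n - 1)`; with indices `a` and sites numbered from `0`, the
usual `n - α` and `N + 1 - x` read `n - (a + 1)` and `N - x`. -/
def gPos {N M : ℕ} (s : ℝ) (x : Fin M → Fin N) (n : ℕ) : ℝ :=
  ∑ e : Fin n → Fin M with StrictMono e, ∏ a : Fin n,
    ((n : ℝ) - ((a.val : ℝ) + 1) + 2 * s * ((N : ℝ) - ((x (e a)).val : ℝ))) /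
    ((n : ℝ) - ((a.val : ℝ) + 1) + 2 * s * ((N : ℝ) + 1))

/-- `x` lists in nondecreasing order the positions of the particles of the configuration `ξ`
(`ξ i` particles at site `i`). -/
def IsPositions {N M : ℕ} (ξ : Fin N → ℕ) (x : Fin M → Fin N) : Prop :=
  Monotone x ∧ ∀ i, Nat.card {k : Fin M // x k = i} = ξ i

end HeatConduction

end

open Finset.HasAntidiagonal (antidiagonal)

noncomputable section

namespace HeatConduction

/-! Write c = 2s. The proof rests on duality. On normalized monomials, the generator in y acts as an
operator `dualGen` in ξ. That operator generates a particle system in which k of the k + m particles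
at a site move to either neighbour at rate `hopRate c k m`, and particles leaving the chain are
absorbed with a factor T_L or T_R each (`generator_normMonomial`). It remains to solve `dualGen` u =
0 with u(0) = 1, and to show that the stationary moments are this solution.

The solution is explicit. Let 0 = S_0 < S_1 < ⋯ < S_{N+1} = 1 be the partial sums of a Dirichlet
vector with N + 1 parameters all equal to c, and put G(ξ) = E ∏ (T_R + (T_L - T_R) S_{N+1-i})^{ξ_i},
sites being numbered from 1 (`steadyMoment`). The ratios S_q / S_{q+1} are independent Beta(cq, c)
variables, so mixed moments of the S_q are products. Given the other sums, S_r has a symmetric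
Beta(c, c) position between its two neighbours, and this law is invariant when S_r moves a fraction
u of the way to either neighbour with intensity u⁻¹(1 - u)^(c-1) du. The expectation is encoded as a
linear functional on polynomials, and the invariance becomes the identity
`sum_hopRate_mul_beta_moments`, which yields `dualGen_steadyMoment`. Expanding the powers gives the
sum of the g_ξ(n) (`steadyMoment_eq_sum_gOcc`); g_x(n) is the same sum organized by subsets of
particles (`gPos_eq_gOcc`).

Moments of μ are not known to be finite in advance. A Lyapunov function for the absorbed dual system
and Grönwall's inequality show that E_y of each monomial converges exponentially fast to G(ξ) for
every y (`exists_exponential_decay`). Integrating truncated monomials against μ then gives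
integrability, and integrating the exponential bound identifies the moments. -/

/-! ### Rising factorials, negative binomial coefficients and hop rates -/

/-- The rising factorial `x (x + 1) ⋯ (x + n - 1)`. -/
def risingFac (x : ℝ) (n : ℕ) : ℝ := ∏ j ∈ Finset.range n, (x + j)

@[simp] lemma risingFac_zero (x : ℝ) : risingFac x 0 = 1 := by simp [risingFac]

lemma risingFac_succ (x : ℝ) (n : ℕ) : risingFac x (n + 1) = risingFac x n * (x + n) :=
  Finset.prod_range_succ _ _

lemma risingFac_add (x : ℝ) (m n : ℕ) :
    risingFac x (m + n) = risingFac x m * risingFac (x + m) n := by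
  simp only [risingFac, Finset.prod_range_add, Nat.cast_add, add_assoc]

lemma risingFac_pos {x : ℝ} (hx : 0 < x) (n : ℕ) : 0 < risingFac x n :=
  Finset.prod_pos fun _ _ => by positivity

lemma risingFac_zero_left {n : ℕ} (hn : n ≠ 0) : risingFac 0 n = 0 :=
  Finset.prod_eq_zero (Finset.mem_range.2 (Nat.pos_of_ne_zero hn)) (by simp)

lemma Gamma_add_nat {x : ℝ} (hx : 0 < x) (n : ℕ) :
    Real.Gamma (x + n) = Real.Gamma x * risingFac x n := by
  induction n with
  | zero => simp
  | succ n ih =>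
    rw [risingFac_succ, Nat.cast_add, Nat.cast_one, ← add_assoc,
      Real.Gamma_add_one (by positivity), ih]
    ring

/-- The coefficient of `t ^ n` in `(1 - t) ^ (-c)`. -/
def negBinomCoeff (c : ℝ) (n : ℕ) : ℝ := risingFac c n / n.factorial

@[simp] lemma negBinomCoeff_zero (c : ℝ) : negBinomCoeff c 0 = 1 := by simp [negBinomCoeff]

lemma negBinomCoeff_succ (c : ℝ) (n : ℕ) :
    (n + 1) * negBinomCoeff c (n + 1) = (c + n) * negBinomCoeff c n := by
  have : ((n.factorial : ℕ) : ℝ) ≠ 0 := by positivity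
  have h2 : (n + 1 : ℝ) ≠ 0 := by positivity
  rw [negBinomCoeff, negBinomCoeff, risingFac_succ, Nat.factorial_succ]
  push_cast
  field_simp

lemma negBinomCoeff_pos {c : ℝ} (hc : 0 < c) (n : ℕ) : 0 < negBinomCoeff c n :=
  div_pos (risingFac_pos hc n) (by positivity)

/-- The rate at which `k ≥ 1` out of `k + m` dual particles leave a site in a given direction.
Its value at `k = 0` is `0`. -/
def hopRate (c : ℝ) (k m : ℕ) : ℝ := negBinomCoeff c m / (k * negBinomCoeff c (k + m))

@[simp] lemma hopRate_zero_left (c : ℝ) (m : ℕ) : hopRate c 0 m = 0 := by simp [hopRate]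

lemma hopRate_nonneg {c : ℝ} (hc : 0 < c) (k m : ℕ) : 0 ≤ hopRate c k m :=
  div_nonneg (negBinomCoeff_pos hc m).le (mul_nonneg k.cast_nonneg (negBinomCoeff_pos hc _).le)

lemma hopRate_pos {c : ℝ} (hc : 0 < c) {k : ℕ} (hk : k ≠ 0) (m : ℕ) : 0 < hopRate c k m :=
  div_pos (negBinomCoeff_pos hc m) (mul_pos (by positivity) (negBinomCoeff_pos hc _))

/-! ### Summation identities behind the invariance of the Beta law -/

lemma sum_antidiagonal_ite_fst {n : ℕ} (f : ℕ → ℝ) :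
    (∑ p ∈ antidiagonal n, if p.1 = 0 then f p.2 else 0) = f n := by
  rw [Finset.sum_eq_single (0, n)]
  · simp
  · rintro ⟨i, j⟩ h h2
    rw [if_neg]
    rintro rfl
    simp_all
  · simp

/-- Coefficients of a zero-balanced hypergeometric series `₂F₁(A, B; A + B; t)`, convolved with
those of `-log (1 - t)`. -/
lemma sum_antidiagonal_inv_mul_zeroBalanced {A B : ℝ} (hA : 0 < A) (hB : 0 < B) (a : ℕ) :
    ∑ p ∈ antidiagonal a,
        (p.1 : ℝ)⁻¹ * (negBinomCoeff A p.2 * risingFac B p.2 / risingFac (A + B) p.2) =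
      negBinomCoeff A a * risingFac B a / risingFac (A + B) a *
        ∑ j ∈ Finset.range a, (1 / (A + j) + 1 / (B + j)) := by
  set r : ℕ → ℝ := fun n => negBinomCoeff A n * risingFac B n / risingFac (A + B) n with hr
  change ∑ p ∈ antidiagonal a, (p.1 : ℝ)⁻¹ * r p.2 = r a * _
  have hrec : ∀ n : ℕ, (n + 1) * (A + B + n) * r (n + 1) = (A + n) * (B + n) * r n := by
    intro n
    have h1 := negBinomCoeff_succ A n
    have h3 : risingFac (A + B) n ≠ 0 := (risingFac_pos (by positivity) n).ne'
    have h4 : A + B + n ≠ 0 := by positivity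
    simp only [hr, risingFac_succ]
    field_simp
    linear_combination (risingFac B n) * h1
  induction a with
  | zero => simp
  | succ a ih =>
    -- The quadratic x(A + B + x - 1) at x = a + 1 and at x = p.2 differs by a multiple of p.1,
    -- which cancels the inverse. Terms with p.1 = 0 vanish because 0⁻¹ = 0.
    have h1 : (a + 1 : ℝ) * (A + B + a) * ∑ p ∈ antidiagonal (a + 1), (p.1 : ℝ)⁻¹ * r p.2 =
        ∑ p ∈ antidiagonal (a + 1), (p.1 : ℝ)⁻¹ * (p.2 * (A + B + p.2 - 1)) * r p.2 +
        ∑ p ∈ antidiagonal (a + 1), ((p.1 : ℝ)⁻¹ * p.1) * (A + B + a + p.2) * r p.2 := by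
      rw [Finset.mul_sum, ← Finset.sum_add_distrib]
      refine Finset.sum_congr rfl fun p hp => ?_
      have : (p.1 + p.2 : ℝ) = a + 1 := by exact_mod_cast Finset.HasAntidiagonal.mem_antidiagonal.1 hp
      obtain h | h := eq_or_ne p.1 0
      · simp [h]
      · have : (p.1 : ℝ) ≠ 0 := by exact_mod_cast h
        rw [show (a : ℝ) = p.1 + p.2 - 1 by linarith]
        field_simp
        ring
    -- The same splitting for (A + x)(B + x). The second sum no longer carries (p.1)⁻¹ * p.1, so its
    -- term at p.1 = 0 has to be subtracted.
    have h2 : (A + a) * (B + a) * ∑ p ∈ antidiagonal a, (p.1 : ℝ)⁻¹ * r p.2 =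
        ∑ p ∈ antidiagonal a, (p.1 : ℝ)⁻¹ * ((A + p.2) * (B + p.2)) * r p.2 +
        ∑ p ∈ antidiagonal a, (A + B + a + p.2) * r p.2 - (A + B + 2 * a) * r a := by
      rw [Finset.mul_sum, ← Finset.sum_add_distrib,
        ← sum_antidiagonal_ite_fst (fun j => (A + B + 2 * a) * r j), ← Finset.sum_sub_distrib]
      refine Finset.sum_congr rfl fun p hp => ?_
      have : (p.1 + p.2 : ℝ) = a := by exact_mod_cast Finset.HasAntidiagonal.mem_antidiagonal.1 hp
      obtain h | h := eq_or_ne p.1 0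
      · simp only [h, Nat.cast_zero, zero_add] at this
        simp [h, this]; ring
      · rw [if_neg h, ← this]
        have : (p.1 : ℝ) ≠ 0 := by exact_mod_cast h
        field_simp
        ring
    rw [Finset.Nat.sum_antidiagonal_succ'
      (f := fun p : ℕ × ℕ => (p.1 : ℝ)⁻¹ * (p.2 * (A + B + p.2 - 1)) * r p.2),
      Finset.Nat.sum_antidiagonal_succ (f := fun p : ℕ × ℕ => ((p.1 : ℝ)⁻¹ * p.1) * (A + B + a + p.2) * r p.2)] at h1
    have h3 : ∀ p : ℕ × ℕ, (p.1 : ℝ)⁻¹ * ((p.2 + 1 : ℕ) * (A + B + (p.2 + 1 : ℕ) - 1)) *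
        r (p.2 + 1) = (p.1 : ℝ)⁻¹ * ((A + p.2) * (B + p.2)) * r p.2 := by
      intro p
      push_cast
      linear_combination (p.1 : ℝ)⁻¹ * hrec p.2
    have h4 : ∀ p : ℕ × ℕ, (((p.1 + 1 : ℕ) : ℝ)⁻¹ * (p.1 + 1 : ℕ)) * (A + B + a + p.2) * r p.2 =
        (A + B + a + p.2) * r p.2 := by
      intro p
      rw [inv_mul_cancel₀ (by positivity), one_mul]
    simp only [h3, h4] at h1
    rw [Finset.sum_range_succ, ← mul_right_inj' (show (a + 1 : ℝ) * (A + B + a) ≠ 0 by positivity),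
      ← mul_assoc _ (r _), hrec a, h1]
    rw [ih] at h2
    have h5 : A + a ≠ 0 := by positivity
    have h6 : B + a ≠ 0 := by positivity
    have h7 : (A + a) * (B + a) * r a * (1 / (A + a) + 1 / (B + a)) = (A + B + 2 * a) * r a := by
      field_simp
      ring
    simp only [Nat.cast_zero, zero_mul, mul_zero, inv_zero]
    linear_combination -h2 - h7

/-- Recurrence for the convolution of `p k / k` with the coefficients of `(1 - t) ^ (-c)`. -/
lemma sum_antidiagonal_inv_mul_negBinomCoeff_succ (c : ℝ) (p : ℕ → ℝ) (a : ℕ) :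
    (a + 1) * ∑ x ∈ antidiagonal (a + 1), (x.1 : ℝ)⁻¹ * p x.1 * negBinomCoeff c x.2 =
      (c + a) * (∑ x ∈ antidiagonal a, (x.1 : ℝ)⁻¹ * p x.1 * negBinomCoeff c x.2) +
        ∑ x ∈ antidiagonal a, p (x.1 + 1) * negBinomCoeff (c - 1) x.2 := by
  have hd : ∀ n : ℕ, negBinomCoeff (c - 1) (n + 1) =
      negBinomCoeff c (n + 1) - negBinomCoeff c n := by
    intro n
    have e : risingFac (c - 1) (n + 1) = (c - 1) * risingFac c n := by
      rw [add_comm, risingFac_add, show (c - 1 + (1 : ℕ) : ℝ) = c by push_cast; ring]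
      simp [risingFac]
    have h2 : ((n.factorial : ℕ) : ℝ) ≠ 0 := by positivity
    have h3 : (n + 1 : ℝ) ≠ 0 := by positivity
    simp only [negBinomCoeff, e, risingFac_succ, Nat.factorial_succ]
    push_cast
    field_simp
    ring
  have e1 : ∑ x ∈ antidiagonal a, p (x.1 + 1) * negBinomCoeff (c - 1) x.2 =
      ∑ x ∈ antidiagonal a, p (x.1 + 1) * negBinomCoeff c x.2 -
      ∑ x ∈ antidiagonal a, ((x.1 : ℝ)⁻¹ * x.1) * p x.1 * negBinomCoeff c x.2 := by
    cases a with
    | zero => simp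
    | succ a =>
      rw [Finset.Nat.sum_antidiagonal_succ', Finset.Nat.sum_antidiagonal_succ',
        Finset.Nat.sum_antidiagonal_succ (f := fun x : ℕ × ℕ => ((x.1 : ℝ)⁻¹ * x.1) * p x.1 *
          negBinomCoeff c x.2)]
      have h1 : ∀ k : ℕ, ((k : ℝ) + 1)⁻¹ * (k + 1) = 1 := fun k => inv_mul_cancel₀ (by positivity)
      simp only [hd, mul_sub, Finset.sum_sub_distrib]
      simp [h1, add_sub_assoc]
  have e2 : (a + 1) * ∑ x ∈ antidiagonal (a + 1), (x.1 : ℝ)⁻¹ * p x.1 * negBinomCoeff c x.2 =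
      ∑ x ∈ antidiagonal a, p (x.1 + 1) * negBinomCoeff c x.2 +
      ∑ x ∈ antidiagonal a, (x.1 : ℝ)⁻¹ * p x.1 * ((c + x.2) * negBinomCoeff c x.2) := by
    have : (a + 1) * ∑ x ∈ antidiagonal (a + 1), (x.1 : ℝ)⁻¹ * p x.1 * negBinomCoeff c x.2 =
        ∑ x ∈ antidiagonal (a + 1), ((x.1 : ℝ)⁻¹ * x.1) * p x.1 * negBinomCoeff c x.2 +
        ∑ x ∈ antidiagonal (a + 1), (x.1 : ℝ)⁻¹ * p x.1 * (x.2 * negBinomCoeff c x.2) := by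
      rw [Finset.mul_sum, ← Finset.sum_add_distrib]
      refine Finset.sum_congr rfl fun x hx => ?_
      have : (x.1 + x.2 : ℝ) = a + 1 := by exact_mod_cast Finset.HasAntidiagonal.mem_antidiagonal.1 hx
      rw [← this]; ring
    rw [this, Finset.Nat.sum_antidiagonal_succ, Finset.Nat.sum_antidiagonal_succ']
    simp only [← negBinomCoeff_succ, Nat.cast_add, Nat.cast_one]
    simp
    refine Finset.sum_congr rfl fun x _ => ?_
    rw [inv_mul_cancel₀ (by positivity), one_mul]
  rw [e1, e2, Finset.mul_sum, add_sub_left_comm, ← Finset.sum_sub_distrib]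
  congr 1
  refine Finset.sum_congr rfl fun x hx => ?_
  have : (x.1 + x.2 : ℝ) = a := by exact_mod_cast Finset.HasAntidiagonal.mem_antidiagonal.1 hx
  rw [← this]; ring

/-- Coefficients in (1 - t)⁻¹ (1 - t)^(1-c) = (1 - t)^(-c). -/
lemma sum_antidiagonal_negBinomCoeff_sub_one (c : ℝ) (a : ℕ) :
    ∑ x ∈ antidiagonal a, negBinomCoeff (c - 1) x.2 = negBinomCoeff c a := by
  induction a with
  | zero => simp
  | succ a ih =>
    have e : risingFac (c - 1) (a + 1) = (c - 1) * risingFac c a := by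
      rw [add_comm, risingFac_add, show (c - 1 + (1 : ℕ) : ℝ) = c by push_cast; ring]
      simp [risingFac]
    rw [Finset.Nat.sum_antidiagonal_succ, ih]
    have h2 : ((a.factorial : ℕ) : ℝ) ≠ 0 := by positivity
    have h3 : (a + 1 : ℝ) ≠ 0 := by positivity
    simp only [negBinomCoeff, e, risingFac_succ, Nat.factorial_succ]
    push_cast
    field_simp
    ring

/-- The ratios are the moments of a Beta(b, c) law, and their first-order recurrence reduces the sum
for a + 1 to the sum for a. -/
lemma sum_antidiagonal_ratio_mul_negBinomCoeff {c b : ℝ} (hc : 0 < c) (hb : 0 ≤ b) (a : ℕ) :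
    (b + c + a) * ∑ x ∈ antidiagonal a,
        risingFac b (x.1 + 1) / risingFac (b + c) (x.1 + 1) * negBinomCoeff (c - 1) x.2 =
      b * negBinomCoeff c a := by
  set p : ℕ → ℝ := fun k => risingFac b k / risingFac (b + c) k with hp
  have hprec : ∀ k : ℕ, p (k + 1) * (b + c + k) = p k * (b + k) := by
    intro k
    have h1 : b + c + k ≠ 0 := by positivity
    have h2 := (risingFac_pos (show 0 < b + c by positivity) k).ne'
    simp only [hp, risingFac_succ]
    field_simp
  have key : ∀ a : ℕ, (b + c + a) * ∑ x ∈ antidiagonal a, p (x.1 + 1) * negBinomCoeff (c - 1) x.2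
      = ∑ x ∈ antidiagonal a, p x.1 * (b + x.1) * negBinomCoeff (c - 1) x.2 +
        ∑ x ∈ antidiagonal a, p (x.1 + 1) * (x.2 * negBinomCoeff (c - 1) x.2) := by
    intro a
    rw [Finset.mul_sum, ← Finset.sum_add_distrib]
    refine Finset.sum_congr rfl fun x hx => ?_
    have : (x.1 + x.2 : ℝ) = a := by exact_mod_cast Finset.HasAntidiagonal.mem_antidiagonal.1 hx
    rw [← hprec, ← this]; ring
  induction a with
  | zero => rw [key]; simp [hp]
  | succ a ih =>
    rw [key, Finset.Nat.sum_antidiagonal_succ, Finset.Nat.sum_antidiagonal_succ']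
    have e : ∀ x ∈ antidiagonal a, p (x.1 + 1) * (b + (x.1 + 1 : ℕ)) * negBinomCoeff (c - 1) x.2 +
        p (x.1 + 1) * ((x.2 + 1 : ℕ) * negBinomCoeff (c - 1) (x.2 + 1)) =
        (b + c + a) * (p (x.1 + 1) * negBinomCoeff (c - 1) x.2) := by
      intro x hx
      have : (x.1 + x.2 : ℝ) = a := by exact_mod_cast Finset.HasAntidiagonal.mem_antidiagonal.1 hx
      rw [← this, Nat.cast_add x.2, Nat.cast_one, negBinomCoeff_succ]
      push_cast
      ring
    have e2 := Finset.sum_congr rfl e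
    rw [Finset.sum_add_distrib, ← Finset.mul_sum, ih] at e2
    rw [← sum_antidiagonal_negBinomCoeff_sub_one c (a + 1), Finset.Nat.sum_antidiagonal_succ,
      sum_antidiagonal_negBinomCoeff_sub_one]
    simp only [hp] at e2 ⊢
    simp
    simp at e2
    linear_combination e2

lemma hopRate_eq {c : ℝ} {a : ℕ} {x : ℕ × ℕ} (hx : x ∈ antidiagonal a) :
    hopRate c x.1 x.2 = (x.1 : ℝ)⁻¹ * negBinomCoeff c x.2 / negBinomCoeff c a := by
  rw [hopRate, Finset.HasAntidiagonal.mem_antidiagonal.1 hx]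
  ring

/-- The convolution of p k / k with the negative binomial coefficients satisfies the recurrence of
those coefficients with a source term. Dividing by them makes it telescope, with increments e j. -/
lemma sum_inv_mul_negBinomCoeff_eq {c : ℝ} (hc : 0 < c) (p e : ℕ → ℝ)
    (h : ∀ a : ℕ, ∑ x ∈ antidiagonal a, p (x.1 + 1) * negBinomCoeff (c - 1) x.2 =
      (c + a) * e a * negBinomCoeff c a) (a : ℕ) :
    ∑ x ∈ antidiagonal a, hopRate c x.1 x.2 * p x.1 = ∑ j ∈ Finset.range a, e j := by
  have : ∑ x ∈ antidiagonal a, (x.1 : ℝ)⁻¹ * p x.1 * negBinomCoeff c x.2 =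
      negBinomCoeff c a * ∑ j ∈ Finset.range a, e j := by
    induction a with
    | zero => simp
    | succ a ih =>
      have h1 := sum_antidiagonal_inv_mul_negBinomCoeff_succ c p a
      have h2 := negBinomCoeff_succ c a
      rw [ih, h] at h1
      rw [Finset.sum_range_succ, ← mul_right_inj' (show (a + 1 : ℝ) ≠ 0 by positivity), h1]
      linear_combination -(∑ j ∈ Finset.range a, e j + e a) * h2
  rw [← mul_right_inj' (negBinomCoeff_pos hc a).ne', ← this, Finset.mul_sum]
  refine Finset.sum_congr rfl fun x hx => ?_
  have := (negBinomCoeff_pos hc a).ne'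
  rw [hopRate_eq hx]
  field_simp

/-- The total rate at which `a` dual particles leave a site in a given direction. -/
lemma sum_hopRate {c : ℝ} (hc : 0 < c) (a : ℕ) :
    ∑ x ∈ antidiagonal a, hopRate c x.1 x.2 = ∑ j ∈ Finset.range a, 1 / (c + j) := by
  have := sum_inv_mul_negBinomCoeff_eq hc (fun _ => 1) (fun j => 1 / (c + j)) (fun a => by
    have : c + a ≠ 0 := by positivity
    simp only [one_mul, sum_antidiagonal_negBinomCoeff_sub_one]
    field_simp) a
  simpa using this

lemma sum_hopRate_mul_ratio {c b : ℝ} (hc : 0 < c) (hb : 0 ≤ b) (a : ℕ) :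
    ∑ x ∈ antidiagonal a, hopRate c x.1 x.2 * (risingFac b x.1 / risingFac (b + c) x.1) =
      ∑ j ∈ Finset.range a, (1 / (c + j) - 1 / (b + c + j)) := by
  refine sum_inv_mul_negBinomCoeff_eq hc (fun k => risingFac b k / risingFac (b + c) k) _
    (fun a => ?_) a
  have h1 : c + a ≠ 0 := by positivity
  have h2 : b + c + a ≠ 0 := by positivity
  rw [← mul_right_inj' h2, sum_antidiagonal_ratio_mul_negBinomCoeff hc hb]
  field_simp
  ring

/-- The Beta moments annihilated by the single-site generator. -/
lemma sum_hopRate_mul_beta_moments {c b : ℝ} (hc : 0 < c) (hb : 0 ≤ b) (a : ℕ) :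
    ∑ x ∈ antidiagonal a, hopRate c x.1 x.2 *
      (risingFac (b + c) x.2 / risingFac (b + 2 * c) x.2 +
        risingFac b x.1 / risingFac (b + c) x.1 *
          (risingFac (b + c) a / risingFac (b + 2 * c) a) -
        2 * (risingFac (b + c) a / risingFac (b + 2 * c) a)) = 0 := by
  have h1 := sum_antidiagonal_inv_mul_zeroBalanced hc (show 0 < b + c by positivity) a
  have h2 := sum_hopRate_mul_ratio hc hb a
  have h3 := sum_hopRate hc a
  rw [show c + (b + c) = b + 2 * c by ring] at h1
  have h4 : ∑ x ∈ antidiagonal a, hopRate c x.1 x.2 *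
      (risingFac (b + c) x.2 / risingFac (b + 2 * c) x.2) =
      risingFac (b + c) a / risingFac (b + 2 * c) a *
        ∑ j ∈ Finset.range a, (1 / (c + j) + 1 / (b + c + j)) := by
    have hq := (negBinomCoeff_pos hc a).ne'
    rw [← mul_right_inj' hq, ← mul_assoc, ← mul_div_assoc, ← h1, Finset.mul_sum]
    refine Finset.sum_congr rfl fun x hx => ?_
    rw [hopRate_eq hx]
    field_simp
  simp only [mul_sub, mul_add, Finset.sum_sub_distrib, Finset.sum_add_distrib, ← mul_assoc,
    ← Finset.sum_mul] at *
  -- The three parts are harmonic sums: 1/(c+j) + 1/(b+c+j) from one neighbour, 1/(c+j) - 1/(b+c+j)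
  -- from the other, and -2/(c+j) from the loss term. They cancel for each j.
  rw [h4, h2, h3]
  ring

/-! ### Hop rates as Beta integrals and the relaxation operator -/

lemma negBinomCoeff_add_one_succ (c : ℝ) (n : ℕ) :
    negBinomCoeff (c + 1) (n + 1) = negBinomCoeff c (n + 1) + negBinomCoeff (c + 1) n := by
  have h1 := sum_antidiagonal_negBinomCoeff_sub_one (c + 1) (n + 1)
  have h2 := sum_antidiagonal_negBinomCoeff_sub_one (c + 1) n
  rw [Finset.Nat.sum_antidiagonal_succ, h2] at h1
  simpa using h1.symm

/-- Coefficients in (1 - t)^(-(n+1)) (1 - t)^(-c) = (1 - t)^(-(c+n+1)). -/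
lemma sum_antidiagonal_choose_mul_negBinomCoeff (c : ℝ) (n N : ℕ) :
    ∑ x ∈ antidiagonal N, ((x.1 + n).choose n : ℝ) * negBinomCoeff c x.2 =
      negBinomCoeff (c + n + 1) N := by
  induction n generalizing N with
  | zero =>
    have := sum_antidiagonal_negBinomCoeff_sub_one (c + 1) N
    simpa using this
  | succ n ih =>
    induction N with
    | zero => simp
    | succ N ih2 =>
      have h := ih (N + 1)
      rw [Finset.Nat.sum_antidiagonal_succ] at h ⊢
      push_cast at ih2 ⊢
      rw [negBinomCoeff_add_one_succ, ← ih2, ← add_assoc c, ← h, add_assoc,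
        ← Finset.sum_add_distrib]
      congr 1
      · simp
      · refine Finset.sum_congr rfl fun x _ => ?_
        rw [show x.1 + 1 + (n + 1) = (x.1 + (n + 1)) + 1 by ring, Nat.choose_succ_succ,
          show x.1 + (n + 1) = x.1 + 1 + n by ring]
        push_cast
        ring

lemma sum_antidiagonal_add_of_eq_zero {M : Type*} [AddCommMonoid M] (f : ℕ × ℕ → M) (n N : ℕ)
    (hf : ∀ k m, k < n → f (k, m) = 0) :
    ∑ x ∈ antidiagonal (n + N), f x = ∑ x ∈ antidiagonal N, f (x.1 + n, x.2) := by
  induction n generalizing f with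
  | zero => simp
  | succ n ih =>
    rw [show n + 1 + N = (n + N) + 1 by ring, Finset.Nat.sum_antidiagonal_succ,
      hf 0 _ n.succ_pos, zero_add, ih (fun x => f (x.1 + 1, x.2)) fun k m h => hf _ _ (by omega)]
    simp only [add_assoc]

/-- The integral of `u ^ (n - 1) (1 - u) ^ (c - 1)` over `[0, 1]` for `n ≥ 1`. -/
def betaWeight (c : ℝ) (n : ℕ) : ℝ := if n = 0 then 0 else (n - 1).factorial / risingFac c n

/-- For k ≥ 1, `hopRate c k m` is the integral of the binomial probability of k successes among k +
m trials against u⁻¹(1 - u)^(c-1) du. The n-th binomial moment of Binomial(a, u) is `a.choose n`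
times u^n, and n ≠ 0 makes it integrable. -/
lemma sum_hopRate_mul_choose {c : ℝ} (hc : 0 < c) (a n : ℕ) (hn : n ≠ 0) :
    ∑ x ∈ antidiagonal a, hopRate c x.1 x.2 * (x.1.choose n : ℝ) =
      betaWeight c n * a.choose n := by
  obtain h | h := lt_or_ge a n
  · rw [Nat.choose_eq_zero_of_lt h, Nat.cast_zero, mul_zero]
    refine Finset.sum_eq_zero fun x hx => ?_
    have := Finset.HasAntidiagonal.mem_antidiagonal.1 hx
    rw [Nat.choose_eq_zero_of_lt (by omega), Nat.cast_zero, mul_zero]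
  obtain ⟨N, rfl⟩ := Nat.exists_eq_add_of_le h
  obtain ⟨n, rfl⟩ := Nat.exists_eq_succ_of_ne_zero hn
  rw [sum_antidiagonal_add_of_eq_zero _ _ _ fun k m h => by
    simp [Nat.choose_eq_zero_of_lt h]]
  have h1 := sum_antidiagonal_choose_mul_negBinomCoeff c n N
  have hq := (negBinomCoeff_pos hc (n + 1 + N)).ne'
  have h2 : ∀ x ∈ antidiagonal N, hopRate c (x.1 + (n + 1)) x.2 *
      ((x.1 + (n + 1)).choose (n + 1) : ℝ) =
      ((x.1 + n).choose n : ℝ) * negBinomCoeff c x.2 /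
        ((n + 1) * negBinomCoeff c (n + 1 + N)) := by
    intro x hx
    have e : x.1 + (n + 1) + x.2 = n + 1 + N := by
      have := Finset.HasAntidiagonal.mem_antidiagonal.1 hx
      omega
    have h3 : ((x.1 + n + 1 : ℕ) : ℝ) * (x.1 + n).choose n =
        (x.1 + n + 1).choose (n + 1) * (n + 1 : ℕ) := by
      exact_mod_cast Nat.add_one_mul_choose_eq (x.1 + n) n
    have h4 : ((x.1 + n + 1 : ℕ) : ℝ) ≠ 0 := by positivity
    rw [hopRate, e, ← add_assoc]
    rw [div_mul_eq_mul_div, div_eq_div_iff (by positivity) (by positivity)]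
    push_cast at h3 ⊢
    linear_combination -negBinomCoeff c x.2 * negBinomCoeff c (n + 1 + N) * h3
  rw [Finset.sum_congr rfl h2, ← Finset.sum_div, h1]
  have h5 : ((n + 1 + N).choose (n + 1) : ℝ) * (n + 1).factorial * N.factorial =
      (n + 1 + N).factorial := by
    have := Nat.add_choose_mul_factorial_mul_factorial (n + 1) N
    rw [← Nat.choose_symm_add] at this
    exact_mod_cast this
  have h6 := (risingFac_pos hc (n + 1)).ne'
  have h7 := (risingFac_pos (show 0 < c + (n + 1 : ℕ) by positivity) N).ne'
  have h8 : ((N.factorial : ℕ) : ℝ) ≠ 0 := by positivity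
  have h9 : ((n.factorial : ℕ) : ℝ) ≠ 0 := by positivity
  have h10 : (((n + 1 + N).factorial : ℕ) : ℝ) ≠ 0 := by positivity
  rw [Nat.factorial_succ] at h5
  simp only [negBinomCoeff, betaWeight, risingFac_add c (n + 1) N, if_neg (Nat.succ_ne_zero n),
    Nat.add_sub_cancel, Nat.succ_eq_add_one]
  push_cast at h5 h7 ⊢
  simp only [← add_assoc] at h7 ⊢
  field_simp
  linear_combination -h5

section CommRing

variable {R : Type*} [CommRing R] [Algebra ℝ R]

/-- The generator of `w ↦ (1 - u) w + u x`, `u` having intensity `u⁻¹ (1 - u) ^ (c - 1) du`, applied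
to `w ^ a`. -/
def relaxation (c : ℝ) (a : ℕ) (w x : R) : R :=
  ∑ p ∈ antidiagonal a, hopRate c p.1 p.2 • (x ^ p.1 * w ^ p.2 - w ^ a)

open Polynomial in
/-- The linear functional `u ^ n ↦ betaWeight c n`. -/
def betaFunctional (c : ℝ) : R[X] →ₗ[R] R :=
  Polynomial.lsum fun n => betaWeight c n • LinearMap.id

open Polynomial in
lemma betaFunctional_C_mul_X_pow (c : ℝ) (r : R) (n : ℕ) :
    betaFunctional c (C r * X ^ n) = betaWeight c n • r := by
  rw [betaFunctional, Polynomial.lsum_apply, Polynomial.C_mul_X_pow_eq_monomial,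
    Polynomial.sum_monomial_index _ _ (by simp)]
  simp

open Polynomial in
-- Both sides stand for the integral of ((1 - u) w + u x)^a - w^a against u⁻¹(1 - u)^(c-1) du: the
-- left is expanded in powers of x and w, the right in powers of u. The subtraction of w^a is hidden
-- in `betaWeight c 0 = 0`.
lemma relaxation_eq_betaFunctional {c : ℝ} (hc : 0 < c) (a : ℕ) (w x : R) :
    relaxation c a w x = betaFunctional c ((C w + C (x - w) * X) ^ a) := by
  have key : ∀ p ∈ antidiagonal a, x ^ p.1 * w ^ p.2 - w ^ a =
      ∑ n ∈ Finset.range a,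
        (p.1.choose (n + 1) : ℝ) • ((x - w) ^ (n + 1) * w ^ (a - (n + 1))) := by
    intro p hp
    have hp := Finset.HasAntidiagonal.mem_antidiagonal.1 hp
    have e : x ^ p.1 * w ^ p.2 = ∑ n ∈ Finset.range (a + 1),
        (p.1.choose n : ℝ) • ((x - w) ^ n * w ^ (a - n)) := by
      have hs : Finset.range (p.1 + 1) ⊆ Finset.range (a + 1) :=
        Finset.range_subset_range.2 (by omega)
      nth_rw 1 [← sub_add_cancel x w]
      rw [add_pow, Finset.sum_mul, ← Finset.sum_subset hs]
      · refine Finset.sum_congr rfl fun n hn => ?_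
        have hn := Finset.mem_range.1 hn
        rw [show a - n = (p.1 - n) + p.2 by omega, pow_add, Nat.cast_smul_eq_nsmul,
          nsmul_eq_mul]
        ring
      · intro n _ hn
        rw [Nat.choose_eq_zero_of_lt (by simpa using hn), Nat.cast_zero, zero_smul]
    rw [e, Finset.sum_range_succ']
    simp
  rw [relaxation, Finset.sum_congr rfl fun p hp => by rw [key p hp, Finset.smul_sum],
    Finset.sum_comm, add_comm, add_pow, map_sum, Finset.sum_range_succ']
  have h0 : betaFunctional c ((C (x - w) * X) ^ 0 * C w ^ (a - 0) * (a.choose 0 : R[X])) = 0 := by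
    have := betaFunctional_C_mul_X_pow c (w ^ a) 0
    simpa [betaWeight] using this
  rw [h0, add_zero]
  refine Finset.sum_congr rfl fun n _ => ?_
  have e : (C (x - w) * X) ^ (n + 1) * C w ^ (a - (n + 1)) * (a.choose (n + 1) : R[X]) =
      C ((x - w) ^ (n + 1) * w ^ (a - (n + 1)) * a.choose (n + 1)) * X ^ (n + 1) := by
    simp only [C_mul, C_pow, map_natCast]
    ring
  rw [e, betaFunctional_C_mul_X_pow, mul_comm _ ((a.choose (n + 1) : ℕ) : R), ← nsmul_eq_mul,
    ← Nat.cast_smul_eq_nsmul ℝ, smul_smul, ← sum_hopRate_mul_choose hc a _ n.succ_ne_zero,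
    Finset.sum_smul]
  exact Finset.sum_congr rfl fun p _ => smul_smul _ _ _

open Polynomial in
-- Relaxation commutes with translations, so the binomial theorem in z applies under the functional.
-- With `relaxation_smul`, this reduces affine images of the S_q to the S_q themselves.
lemma relaxation_add {c : ℝ} (hc : 0 < c) (a : ℕ) (z w x : R) :
    relaxation c a (z + w) (z + x) =
      ∑ b ∈ Finset.range (a + 1), a.choose b • (z ^ (a - b) * relaxation c b w x) := by
  simp only [relaxation_eq_betaFunctional hc, add_sub_add_left_eq_sub]
  rw [C_add, add_assoc, add_comm (C z), add_pow, map_sum]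
  refine Finset.sum_congr rfl fun b _ => ?_
  rw [← smul_eq_mul (z ^ (a - b)), ← map_smul, ← map_nsmul, nsmul_eq_mul, smul_eq_C_mul, C_pow]
  congr 1
  ring

lemma relaxation_smul (c : ℝ) (a : ℕ) (t : ℝ) (w x : R) :
    relaxation c a (t • w) (t • x) = t ^ a • relaxation c a w x := by
  simp only [relaxation, Finset.smul_sum]
  refine Finset.sum_congr rfl fun p hp => ?_
  rw [← Finset.HasAntidiagonal.mem_antidiagonal.1 hp, smul_comm (t ^ _)]
  congr 1
  simp only [smul_pow, smul_mul_smul_comm, smul_sub, pow_add]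

end CommRing

/-! ### Mixed moments of Dirichlet partial sums -/

/-- The linear functional on polynomials with prescribed values on monomials. -/
def momentFunctional {ι : Type*} (e : (ι →₀ ℕ) → ℝ) : MvPolynomial ι ℝ →ₗ[ℝ] ℝ :=
  (MvPolynomial.basisMonomials ι ℝ).constr ℝ e

@[simp] lemma momentFunctional_monomial {ι : Type*} (e : (ι →₀ ℕ) → ℝ) (m : ι →₀ ℕ) (r : ℝ) :
    momentFunctional e (MvPolynomial.monomial m r) = r * e m := by
  have h : MvPolynomial.monomial m r = r • MvPolynomial.basisMonomials ι ℝ m := by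
    simp [MvPolynomial.smul_monomial]
  rw [h, map_smul, momentFunctional, Module.Basis.constr_basis, smul_eq_mul]

/-- The degree of a monomial in the variables `0, …, q`. -/
def partialDegree (m : ℕ →₀ ℕ) (q : ℕ) : ℕ := ∑ k ∈ Finset.range (q + 1), m k

lemma partialDegree_add (m m' : ℕ →₀ ℕ) (q : ℕ) :
    partialDegree (m + m') q = partialDegree m q + partialDegree m' q :=
  Finset.sum_add_distrib

lemma partialDegree_single (j k q : ℕ) :
    partialDegree (Finsupp.single j k) q = if j ≤ q then k else 0 := by
  simp [partialDegree, Finsupp.single_apply]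

lemma partialDegree_succ (m : ℕ →₀ ℕ) (q : ℕ) :
    partialDegree m (q + 1) = partialDegree m q + m (q + 1) :=
  Finset.sum_range_succ _ _

/-- The moment `E[∏ S_k ^ m_k]`, where `S_k` is the sum of the first `k` components of a symmetric
Dirichlet vector with `N + 1` components and parameter `c`. -/
def dirichletMoment (c : ℝ) (N : ℕ) (m : ℕ →₀ ℕ) : ℝ :=
  ∏ q ∈ Finset.range (N + 1),
    risingFac (c * q) (partialDegree m q) / risingFac (c * (q + 1)) (partialDegree m q)

/-- The expectation of polynomials in the partial sums of a symmetric Dirichlet vector. -/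
def dirichletFunctional (c : ℝ) (N : ℕ) : MvPolynomial ℕ ℝ →ₗ[ℝ] ℝ :=
  momentFunctional (dirichletMoment c N)

/-- This encodes S_0 = 0, through the rising factorial of 0 in the factor q = 0. -/
lemma dirichletMoment_single_zero (c : ℝ) (N : ℕ) (m : ℕ →₀ ℕ) :
    dirichletMoment c N (Finsupp.single 0 1 + m) = 0 := by
  refine Finset.prod_eq_zero (Finset.mem_range.2 N.succ_pos) ?_
  rw [Nat.cast_zero, mul_zero, partialDegree_add, partialDegree_single, if_pos le_rfl,
    risingFac_zero_left (by omega), zero_div]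

/-- This encodes S_{N+1} = 1: the variable N + 1 enters no partial degree with q ≤ N. -/
lemma dirichletMoment_single_last (c : ℝ) (N : ℕ) (m : ℕ →₀ ℕ) :
    dirichletMoment c N (Finsupp.single (N + 1) 1 + m) = dirichletMoment c N m := by
  refine Finset.prod_congr rfl fun q hq => ?_
  rw [partialDegree_add, partialDegree_single, if_neg (by simpa using hq), zero_add]

lemma dirichletFunctional_X_zero_mul (c : ℝ) (N : ℕ) (F : MvPolynomial ℕ ℝ) :
    dirichletFunctional c N (MvPolynomial.X 0 * F) = 0 := by
  induction F using MvPolynomial.induction_on' with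
  | monomial m r =>
    rw [MvPolynomial.X, MvPolynomial.monomial_mul, dirichletFunctional, momentFunctional_monomial,
      dirichletMoment_single_zero, mul_zero]
  | add p q hp hq => rw [mul_add, map_add, hp, hq, add_zero]

lemma dirichletFunctional_X_last_mul (c : ℝ) (N : ℕ) (F : MvPolynomial ℕ ℝ) :
    dirichletFunctional c N (MvPolynomial.X (N + 1) * F) = dirichletFunctional c N F := by
  induction F using MvPolynomial.induction_on' with
  | monomial m r =>
    simp [MvPolynomial.X, MvPolynomial.monomial_mul, dirichletFunctional,
      dirichletMoment_single_last]
  | add p q hp hq => rw [mul_add, map_add, hp, hq, map_add]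

/-- Moving exponents from r + 1 to a neighbour changes only the factors q = r and q = r + 1. Once
the common factors are removed, what remains is `sum_hopRate_mul_beta_moments` with b = c r + Q,
where Q is the degree in the variables up to r. -/
lemma dirichletMoment_balance {c : ℝ} (hc : 0 < c) {N r : ℕ} (hr : r + 1 ≤ N) (a : ℕ)
    (m : ℕ →₀ ℕ) (hm : m (r + 1) = 0) :
    ∑ p ∈ antidiagonal a, hopRate c p.1 p.2 *
      (dirichletMoment c N (m + Finsupp.single (r + 2) p.1 + Finsupp.single (r + 1) p.2) +
        dirichletMoment c N (m + Finsupp.single r p.1 + Finsupp.single (r + 1) p.2) -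
        2 * dirichletMoment c N (m + Finsupp.single (r + 1) a)) = 0 := by
  set g : ℕ → ℕ → ℝ := fun q M => risingFac (c * q) M / risingFac (c * (q + 1)) M with hg
  set S := ((Finset.range (N + 1)).erase r).erase (r + 1) with hS
  set Q := partialDegree m r with hQ
  set K := ∏ q ∈ S, g q (partialDegree m q + if r + 2 ≤ q then a else 0) with hK
  have split : ∀ m', dirichletMoment c N m' = g r (partialDegree m' r) *
      (g (r + 1) (partialDegree m' (r + 1)) * ∏ q ∈ S, g q (partialDegree m' q)) := by
    intro m'
    rw [Finset.mul_prod_erase _ (fun q => g q (partialDegree m' q)) (by simp; omega),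
      Finset.mul_prod_erase _ (fun q => g q (partialDegree m' q)) (by simp; omega)]
    rfl
  have hQ1 : partialDegree m (r + 1) = Q := by rw [partialDegree_succ, hm, add_zero]
  have e1 : ∀ p ∈ antidiagonal a,
      dirichletMoment c N (m + Finsupp.single (r + 2) p.1 + Finsupp.single (r + 1) p.2) =
        g r Q * (g (r + 1) (Q + p.2) * K) := by
    intro p hp
    have hp := Finset.HasAntidiagonal.mem_antidiagonal.1 hp
    simp only [split, partialDegree_add, partialDegree_single, hQ1, ← hQ]
    congr 2
    · simp
    · congr 1; simp
    · refine Finset.prod_congr rfl fun q hq => ?_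
      congr 1
      simp only [hS, Finset.mem_erase] at hq
      split_ifs <;> omega
  have e2 : ∀ p ∈ antidiagonal a,
      dirichletMoment c N (m + Finsupp.single r p.1 + Finsupp.single (r + 1) p.2) =
        g r (Q + p.1) * (g (r + 1) (Q + a) * K) := by
    intro p hp
    have hp := Finset.HasAntidiagonal.mem_antidiagonal.1 hp
    simp only [split, partialDegree_add, partialDegree_single, hQ1, ← hQ]
    congr 2
    · simp
    · congr 1; simp; omega
    · refine Finset.prod_congr rfl fun q hq => ?_
      congr 1
      simp only [hS, Finset.mem_erase] at hq
      split_ifs <;> omega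
  have e3 : dirichletMoment c N (m + Finsupp.single (r + 1) a) =
        g r Q * (g (r + 1) (Q + a) * K) := by
    simp only [split, partialDegree_add, partialDegree_single, hQ1, ← hQ]
    congr 2
    · simp
    · congr 1; simp
    · refine Finset.prod_congr rfl fun q hq => ?_
      congr 1
      simp only [hS, Finset.mem_erase] at hq
      split_ifs <;> omega
  have hb : (0 : ℝ) ≤ c * r + Q := by positivity
  have key := sum_hopRate_mul_beta_moments hc hb a
  have g0 : ∀ k, g r (Q + k) = g r Q * (risingFac (c * r + Q) k / risingFac (c * r + Q + c) k) := by
    intro k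
    simp only [hg, risingFac_add]
    rw [show c * ((r : ℝ) + 1) + Q = c * r + Q + c by ring, mul_div_mul_comm]
  have g1 : ∀ k, g (r + 1) (Q + k) =
      g (r + 1) Q * (risingFac (c * r + Q + c) k / risingFac (c * r + Q + 2 * c) k) := by
    intro k
    simp only [hg, risingFac_add]
    push_cast
    rw [show c * ((r : ℝ) + 1) + Q = c * r + Q + c by ring,
      show c * ((r : ℝ) + 1 + 1) + Q = c * r + Q + 2 * c by ring, mul_div_mul_comm]
  rw [← mul_zero (g r Q * g (r + 1) Q * K), ← key, Finset.mul_sum]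
  refine Finset.sum_congr rfl fun p hp => ?_
  rw [e1 p hp, e2 p hp, e3, g0, g1, g1]
  ring

/-- The conditional law of `S_{r+1}` given the other partial sums is stationary for relaxation
towards the two neighbours. -/
lemma dirichletFunctional_relaxation {c : ℝ} (hc : 0 < c) {N r : ℕ} (hr : r + 1 ≤ N) (a : ℕ)
    {F : MvPolynomial ℕ ℝ} (hF : F ∈ MvPolynomial.supported ℝ ({r + 1}ᶜ : Set ℕ)) :
    dirichletFunctional c N (F * (relaxation c a (MvPolynomial.X (r + 1)) (MvPolynomial.X (r + 2)) +
      relaxation c a (MvPolynomial.X (r + 1)) (MvPolynomial.X r))) = 0 := by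
  rw [F.as_sum, Finset.sum_mul, map_sum]
  refine Finset.sum_eq_zero fun m hm => ?_
  have hm0 : m (r + 1) = 0 := by
    by_contra h
    have h1 : r + 1 ∈ F.vars := (MvPolynomial.mem_vars_iff_mem_support _).2 ⟨m, hm, by simpa using h⟩
    have := (MvPolynomial.mem_supported.1 hF) h1
    simp at this
  have key := dirichletMoment_balance hc hr a m hm0
  rw [relaxation, relaxation, ← Finset.sum_add_distrib, Finset.mul_sum, map_sum,
    ← mul_zero (F.coeff m), ← key, Finset.mul_sum]
  refine Finset.sum_congr rfl fun p _ => ?_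
  simp only [MvPolynomial.X_pow_eq_monomial, MvPolynomial.monomial_mul, ← smul_add,
    mul_smul_comm, map_smul, mul_add, mul_sub, map_add, map_sub, dirichletFunctional,
    momentFunctional_monomial, smul_eq_mul, ← add_assoc, mul_one]
  ring

/-! ### The absorbed dual system and its explicit harmonic function -/

/-- The value of `u` after `k` dual particles leave site `i`, where `m` remain, to the right. Leaving
the last site, they are absorbed and each contributes a factor `TR`. -/
def jumpRight {N : ℕ} (TR : ℝ) (u : (Fin N → ℕ) → ℝ) (ξ : Fin N → ℕ) (i : Fin N) (k m : ℕ) : ℝ :=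
  if h : i.val + 1 < N then u (Function.update ξ i m + Pi.single ⟨i.val + 1, h⟩ k)
  else TR ^ k * u (Function.update ξ i m)

/-- The value of `u` after `k` dual particles leave site `i`, where `m` remain, to the left. Leaving
the first site, they are absorbed and each contributes a factor `TL`. -/
def jumpLeft {N : ℕ} (TL : ℝ) (u : (Fin N → ℕ) → ℝ) (ξ : Fin N → ℕ) (i : Fin N) (k m : ℕ) : ℝ :=
  if h : 0 < i.val then u (Function.update ξ i m + Pi.single ⟨i.val - 1, by omega⟩ k)
  else TL ^ k * u (Function.update ξ i m)

/-- The generator of the dual particle system, absorbed at both ends. -/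
def dualGen {N : ℕ} (c TL TR : ℝ) (u : (Fin N → ℕ) → ℝ) (ξ : Fin N → ℕ) : ℝ :=
  ∑ i, ∑ p ∈ antidiagonal (ξ i), hopRate c p.1 p.2 *
    (jumpRight TR u ξ i p.1 p.2 + jumpLeft TL u ξ i p.1 p.2 - 2 * u ξ)

/-- The local temperature `TR + (TL - TR) S_r`. -/
def temperature (TL TR : ℝ) (r : ℕ) : MvPolynomial ℕ ℝ :=
  algebraMap ℝ _ TR + (TL - TR) • MvPolynomial.X r

/-- The stationary normalized moments: mixed moments of the local temperatures. -/
def steadyMoment {N : ℕ} (c TL TR : ℝ) (ξ : Fin N → ℕ) : ℝ :=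
  dirichletFunctional c N (∏ i : Fin N, temperature TL TR (N - i.val) ^ ξ i)

lemma steadyMoment_zero {N : ℕ} {c : ℝ} (TL TR : ℝ) :
    steadyMoment c TL TR (0 : Fin N → ℕ) = 1 := by
  have : (1 : MvPolynomial ℕ ℝ) = MvPolynomial.monomial 0 1 := rfl
  simp only [steadyMoment, Pi.zero_apply, pow_zero, Finset.prod_const_one]
  rw [this, dirichletFunctional, momentFunctional_monomial, one_mul, dirichletMoment]
  refine Finset.prod_eq_one fun q _ => ?_
  simp [partialDegree]

lemma dirichletFunctional_algebraMap_mul (c : ℝ) (N : ℕ) (t : ℝ) (F : MvPolynomial ℕ ℝ) :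
    dirichletFunctional c N (algebraMap ℝ _ t * F) = t * dirichletFunctional c N F := by
  rw [← Algebra.smul_def, map_smul, smul_eq_mul]

lemma dirichletFunctional_temperature_zero_pow (c : ℝ) (N : ℕ) (TL TR : ℝ) (k : ℕ)
    (F : MvPolynomial ℕ ℝ) :
    dirichletFunctional c N (temperature TL TR 0 ^ k * F) = TR ^ k * dirichletFunctional c N F := by
  induction k with
  | zero => simp
  | succ k ih =>
    rw [pow_succ', mul_assoc, temperature, add_mul, map_add, dirichletFunctional_algebraMap_mul,
      ← temperature, ih, smul_mul_assoc, map_smul, dirichletFunctional_X_zero_mul, smul_zero]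
    ring

lemma dirichletFunctional_temperature_last_pow (c : ℝ) (N : ℕ) (TL TR : ℝ) (k : ℕ)
    (F : MvPolynomial ℕ ℝ) :
    dirichletFunctional c N (temperature TL TR (N + 1) ^ k * F) =
      TL ^ k * dirichletFunctional c N F := by
  induction k with
  | zero => simp
  | succ k ih =>
    rw [pow_succ', mul_assoc, temperature, add_mul, map_add, dirichletFunctional_algebraMap_mul,
      ← temperature, ih, smul_mul_assoc, map_smul, dirichletFunctional_X_last_mul, ih, smul_eq_mul]
    ring

lemma prod_pow_update {N : ℕ} {R : Type*} [CommMonoid R] (t : Fin N → R) (ξ : Fin N → ℕ)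
    (i : Fin N) (m : ℕ) :
    ∏ l, t l ^ Function.update ξ i m l = t i ^ m * ∏ l ∈ Finset.univ.erase i, t l ^ ξ l := by
  rw [← Finset.mul_prod_erase _ _ (Finset.mem_univ i), Function.update_self]
  congr 1
  refine Finset.prod_congr rfl fun l hl => ?_
  rw [Function.update_of_ne (Finset.ne_of_mem_erase hl)]

lemma prod_pow_update_add_single {N : ℕ} {R : Type*} [CommMonoid R] (t : Fin N → R)
    (ξ : Fin N → ℕ) (i j : Fin N) (k m : ℕ) :
    ∏ l, t l ^ (Function.update ξ i m + Pi.single j k : Fin N → ℕ) l =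
      t j ^ k * (t i ^ m * ∏ l ∈ Finset.univ.erase i, t l ^ ξ l) := by
  simp only [Pi.add_apply, pow_add, Finset.prod_mul_distrib, prod_pow_update]
  rw [mul_comm, Finset.prod_eq_single j]
  · simp
  · intro l _ hl
    simp [Pi.single_eq_of_ne hl]
  · simp

/-- Temperatures are a common affine image of the S_q, so the covariance of relaxation under
translation and scaling reduces this to `dirichletFunctional_relaxation`. -/
lemma relaxation_temperature {c : ℝ} (hc : 0 < c) (TL TR : ℝ) {N r : ℕ} (hr : r + 1 ≤ N) (a : ℕ)
    {F : MvPolynomial ℕ ℝ} (hF : F ∈ MvPolynomial.supported ℝ ({r + 1}ᶜ : Set ℕ)) :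
    dirichletFunctional c N (F *
      (relaxation c a (temperature TL TR (r + 1)) (temperature TL TR (r + 2)) +
        relaxation c a (temperature TL TR (r + 1)) (temperature TL TR r))) = 0 := by
  simp only [temperature, relaxation_add hc, relaxation_smul]
  rw [← Finset.sum_add_distrib, Finset.mul_sum, map_sum]
  refine Finset.sum_eq_zero fun b _ => ?_
  rw [← smul_add, ← mul_add, ← smul_add, ← map_pow, ← Algebra.smul_def, mul_smul_comm,
    mul_smul_comm, mul_smul_comm, map_nsmul, map_smul, map_smul,
    dirichletFunctional_relaxation hc hr b hF]
  simp

/-- Each site contributes zero separately: a hop replaces powers of its temperature by powers of a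
neighbour's, which is relaxation. Absorption fits the same pattern, since the temperatures at
indices 0 and N + 1 act as the constants `TR` and `TL`. -/
theorem dualGen_steadyMoment {N : ℕ} {c : ℝ} (hc : 0 < c) (TL TR : ℝ) (ξ : Fin N → ℕ) :
    dualGen c TL TR (steadyMoment c TL TR) ξ = 0 := by
  refine Finset.sum_eq_zero fun i _ => ?_
  obtain ⟨r, hr⟩ : ∃ r, N - i.val = r + 1 := ⟨N - i.val - 1, by omega⟩
  set F := ∏ l ∈ Finset.univ.erase i, temperature TL TR (N - l.val) ^ ξ l with hFdef
  have hF : F ∈ MvPolynomial.supported ℝ ({r + 1}ᶜ : Set ℕ) := by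
    refine Subalgebra.prod_mem _ fun l hl => Subalgebra.pow_mem _ (Subalgebra.add_mem _
      (Subalgebra.algebraMap_mem _ _) (Subalgebra.smul_mem _
        (MvPolynomial.X_mem_supported.2 ?_) _)) _
    have : l.val ≠ i.val := fun h => Finset.ne_of_mem_erase hl (Fin.ext h)
    simp only [Set.mem_compl_iff, Set.mem_singleton_iff]
    omega
  have h0 : steadyMoment c TL TR ξ =
      dirichletFunctional c N (F * temperature TL TR (r + 1) ^ ξ i) := by
    rw [steadyMoment, ← Finset.mul_prod_erase _ _ (Finset.mem_univ i), hr, mul_comm]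
  have hR : ∀ k m, jumpRight TR (steadyMoment c TL TR) ξ i k m =
      dirichletFunctional c N (F * (temperature TL TR r ^ k * temperature TL TR (r + 1) ^ m)) := by
    intro k m
    rw [jumpRight]
    split_ifs with h
    · rw [steadyMoment, prod_pow_update_add_single (fun l : Fin N => temperature TL TR (N - l.val)),
        ← hFdef, hr, show N - (i.val + 1) = r by omega]
      congr 1
      ring
    · obtain rfl : r = 0 := by omega
      rw [steadyMoment, prod_pow_update (fun l : Fin N => temperature TL TR (N - l.val)),
        ← hFdef, hr, mul_left_comm, dirichletFunctional_temperature_zero_pow, mul_comm F]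
  have hL : ∀ k m, jumpLeft TL (steadyMoment c TL TR) ξ i k m =
      dirichletFunctional c N (F * (temperature TL TR (r + 2) ^ k *
        temperature TL TR (r + 1) ^ m)) := by
    intro k m
    rw [jumpLeft]
    split_ifs with h
    · rw [steadyMoment, prod_pow_update_add_single (fun l : Fin N => temperature TL TR (N - l.val)),
        ← hFdef, hr, show N - (i.val - 1) = r + 2 by omega]
      congr 1
      ring
    · obtain rfl : N = r + 1 := by omega
      rw [steadyMoment, prod_pow_update (fun l : Fin (r + 1) => temperature TL TR (r + 1 - l.val)),
        ← hFdef, hr, mul_left_comm, dirichletFunctional_temperature_last_pow, mul_comm F]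
  rw [← relaxation_temperature hc TL TR (show r + 1 ≤ N by omega) (ξ i) hF, relaxation, relaxation,
    ← Finset.sum_add_distrib, Finset.mul_sum, map_sum]
  refine Finset.sum_congr rfl fun p _ => ?_
  rw [hR, hL, h0, ← smul_add, mul_smul_comm, map_smul, smul_eq_mul, mul_add F, mul_sub F,
    mul_sub F, map_add, map_sub, map_sub]
  ring

/-! ### Expansion of the harmonic function in occupation numbers -/

/-- The weight of an occupation vector in `gOcc`. -/
def occWeight {N : ℕ} (s : ℝ) (m : Fin N → ℕ) : ℝ :=
  ∏ i : Fin N, ∏ j ∈ Finset.Icc 1 (m i),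
    (2 * s * ((N : ℝ) - (i.val : ℝ)) - (j : ℝ) + ∑ k ∈ Finset.Ici i, (m k : ℝ)) /
    (2 * s * ((N : ℝ) + 1) - (j : ℝ) + ∑ k ∈ Finset.Ici i, (m k : ℝ))

lemma gOcc_eq_sum_piFinset {N : ℕ} (s : ℝ) (ξ : Fin N → ℕ) (n : ℕ) :
    gOcc s ξ n = ∑ m ∈ Fintype.piFinset (fun i => Finset.range (ξ i + 1)) with ∑ i, m i = n,
      (∏ i, ((ξ i).choose (m i) : ℝ)) * occWeight s m := by
  simp only [gOcc, Finset.prod_mul_distrib, occWeight]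
  symm
  refine Finset.sum_subset (fun m hm => ?_) fun m hm hm2 => ?_
  · simp only [Finset.mem_filter] at hm
    simp [hm.2]
  · have h : ∃ i, ξ i < m i := by
      by_contra! h
      refine hm2 (Finset.mem_filter.2 ⟨Fintype.mem_piFinset.2 fun i => Finset.mem_range.2 ?_, ?_⟩)
      · exact Nat.lt_succ_of_le (h i)
      · simpa using hm
    obtain ⟨i, hi⟩ := h
    rw [Finset.prod_eq_zero (Finset.mem_univ i) (by simp [Nat.choose_eq_zero_of_lt hi]), zero_mul]

lemma prod_Icc_sub (x : ℝ) (M d : ℕ) :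
    ∏ j ∈ Finset.Icc 1 d, (x - (j : ℝ) + ((M + d : ℕ) : ℝ)) = risingFac (x + M) d := by
  refine Finset.prod_nbij' (fun j => d - j) (fun j => d - j) ?_ ?_ ?_ ?_ ?_
  · intro j hj
    simp only [Finset.mem_Icc, Finset.mem_range] at hj ⊢
    omega
  · intro j hj
    simp only [Finset.mem_Icc, Finset.mem_range] at hj ⊢
    omega
  · intro j hj
    simp only [Finset.mem_Icc] at hj
    omega
  · intro j hj
    simp only [Finset.mem_range] at hj
    omega
  · intro j hj
    simp only [Finset.mem_Icc] at hj
    rw [Nat.cast_sub hj.2]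
    push_cast
    ring

/-- The numerator of factor r + 1 is paired with the denominator of factor r, as both have base c(r
+ 1). The unpaired last denominator, with base c(N + 1), is spread over all r by telescoping. -/
lemma dirichletMoment_eq_prod {c : ℝ} (hc : 0 < c) (N : ℕ) (d : ℕ →₀ ℕ) (hd : d 0 = 0) :
    dirichletMoment c N d = ∏ r ∈ Finset.range N,
      risingFac (c * (r + 1) + partialDegree d r) (d (r + 1)) /
        risingFac (c * (N + 1) + partialDegree d r) (d (r + 1)) := by
  have h0 : partialDegree d 0 = 0 := by simp [partialDegree, hd]
  have hC : (0 : ℝ) < c * (N + 1) := by positivity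
  have h1 : ∀ r : ℕ, risingFac (c * (r + 1) + partialDegree d r) (d (r + 1)) /
        risingFac (c * (N + 1) + partialDegree d r) (d (r + 1)) =
      risingFac (c * (r + 1)) (partialDegree d (r + 1)) / risingFac (c * (r + 1)) (partialDegree d r)
      * ((risingFac (c * (N + 1)) (partialDegree d (r + 1)))⁻¹ /
        (risingFac (c * (N + 1)) (partialDegree d r))⁻¹) := by
    intro r
    have h2 := (risingFac_pos (show 0 < c * ((r : ℝ) + 1) by positivity) (partialDegree d r)).ne'
    have h3 := (risingFac_pos hC (partialDegree d r)).ne'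
    have h4 := (risingFac_pos (show 0 < c * ((N : ℝ) + 1) + partialDegree d r by positivity)
      (d (r + 1))).ne'
    rw [partialDegree_succ, risingFac_add, risingFac_add]
    field_simp
  simp only [h1, Finset.prod_mul_distrib, Finset.prod_div_distrib, dirichletMoment]
  have h5 : ∀ n : ℕ, (∏ r ∈ Finset.range n, (risingFac (c * (N + 1)) (partialDegree d (r + 1)))⁻¹) /
      (∏ r ∈ Finset.range n, (risingFac (c * (N + 1)) (partialDegree d r))⁻¹) =
      (risingFac (c * (N + 1)) (partialDegree d n))⁻¹ := by
    intro n
    induction n with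
    | zero => simp [h0]
    | succ n ih =>
      have h3 := (risingFac_pos hC (partialDegree d n)).ne'
      rw [Finset.prod_range_succ, Finset.prod_range_succ, mul_div_mul_comm, ih]
      field_simp
  rw [h5, Finset.prod_range_succ', Finset.prod_range_succ]
  simp only [h0, risingFac_zero, mul_one, Nat.cast_add, Nat.cast_one]
  rw [div_mul_eq_div_div, div_eq_mul_inv]

/-- The exponent vector `m`, with site `i` placed at the variable `N - i`. -/
def siteExponent {N : ℕ} (m : Fin N → ℕ) : ℕ →₀ ℕ :=
  ∑ i : Fin N, Finsupp.single (N - i.val) (m i)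

lemma siteExponent_apply {N : ℕ} (m : Fin N → ℕ) (i : Fin N) :
    siteExponent m (N - i.val) = m i := by
  rw [siteExponent, Finsupp.finsetSum_apply, Finset.sum_eq_single i]
  · simp
  · intro k _ hk
    have : k.val ≠ i.val := fun h => hk (Fin.ext h)
    rw [Finsupp.single_apply, if_neg (by omega)]
  · simp

lemma siteExponent_zero {N : ℕ} (m : Fin N → ℕ) : siteExponent m 0 = 0 := by
  rw [siteExponent, Finsupp.finsetSum_apply]
  refine Finset.sum_eq_zero fun k _ => ?_
  rw [Finsupp.single_apply, if_neg (by omega)]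

lemma partialDegree_siteExponent {N : ℕ} (m : Fin N → ℕ) (i : Fin N) :
    partialDegree (siteExponent m) (N - i.val) = ∑ k ∈ Finset.Ici i, m k := by
  have h : ∀ t : Finset (Fin N), partialDegree (∑ k ∈ t, Finsupp.single (N - k.val) (m k))
      (N - i.val) = ∑ k ∈ t, if i ≤ k then m k else 0 := by
    intro t
    induction t using Finset.induction_on with
    | empty => simp [partialDegree]
    | insert k t hk ih =>
      rw [Finset.sum_insert hk, Finset.sum_insert hk, partialDegree_add, ih, partialDegree_single]
      congr 1
      refine if_congr ?_ rfl rfl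
      rw [Fin.le_def]
      omega
  rw [siteExponent, h, ← Finset.sum_filter]
  congr 1
  ext k
  simp

lemma occWeight_eq_dirichletMoment {N : ℕ} {s : ℝ} (hs : 0 < s) (m : Fin N → ℕ) :
    occWeight s m = dirichletMoment (2 * s) N (siteExponent m) := by
  rw [dirichletMoment_eq_prod (by positivity) _ _ (siteExponent_zero m), Finset.prod_range,
    -- Sites are read from right to left, because the S_q accumulate from the right end of the
    -- chain.
    occWeight, ← Equiv.prod_comp Fin.revPerm]
  refine Finset.prod_congr rfl fun r _ => ?_
  set i := Fin.revPerm r with hi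
  have hval : N - i.val = r.val + 1 := by
    simp only [hi, Fin.revPerm_apply, Fin.val_rev]
    omega
  have hcast : (N : ℝ) - i.val = r.val + 1 := by
    rw [← Nat.cast_sub i.isLt.le, hval]; push_cast; ring
  have hM : ∑ k ∈ Finset.Ici i, (m k : ℝ) =
      ((partialDegree (siteExponent m) r.val + m i : ℕ) : ℝ) := by
    rw [← Nat.cast_sum, ← partialDegree_siteExponent, hval, partialDegree_succ, ← hval,
      siteExponent_apply]
  rw [Finset.prod_div_distrib, hM, hcast, prod_Icc_sub, prod_Icc_sub, ← hval, siteExponent_apply]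

/-- Expand each power of a temperature binomially and collect the terms by the total exponent n of
T_L - T_R. -/
lemma steadyMoment_eq_sum_gOcc {N : ℕ} {s : ℝ} (hs : 0 < s) (TL TR : ℝ) (ξ : Fin N → ℕ) :
    steadyMoment (2 * s) TL TR ξ = ∑ n ∈ Finset.range ((∑ i, ξ i) + 1),
      TR ^ ((∑ i, ξ i) - n) * (TL - TR) ^ n * gOcc s ξ n := by
  have hexp : ∀ i : Fin N, temperature TL TR (N - i.val) ^ ξ i =
      ∑ k ∈ Finset.range (ξ i + 1), MvPolynomial.monomial (Finsupp.single (N - i.val) k)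
        (((ξ i).choose k : ℝ) * (TR ^ (ξ i - k) * (TL - TR) ^ k)) := by
    intro i
    rw [temperature, add_comm, add_pow]
    refine Finset.sum_congr rfl fun k _ => ?_
    rw [smul_pow, MvPolynomial.X_pow_eq_monomial, MvPolynomial.smul_monomial, ← map_pow,
      MvPolynomial.algebraMap_eq, mul_comm _ (MvPolynomial.C _), MvPolynomial.C_mul_monomial,
      ← map_natCast (MvPolynomial.C (R := ℝ) (σ := ℕ)), mul_comm _ (MvPolynomial.C _),
      MvPolynomial.C_mul_monomial]
    simp
  have hprod : ∀ (f : Fin N → ℕ →₀ ℕ) (g : Fin N → ℝ),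
      ∏ i, MvPolynomial.monomial (f i) (g i) = MvPolynomial.monomial (∑ i, f i) (∏ i, g i) :=
    fun f g => (MvPolynomial.monomial_sum_prod _ f g).symm
  rw [steadyMoment, Finset.prod_congr rfl fun i _ => hexp i, Finset.prod_univ_sum, map_sum]
  rw [← Finset.sum_fiberwise_of_maps_to (g := fun m : Fin N → ℕ => ∑ i, m i)
    (t := Finset.range ((∑ i, ξ i) + 1))]
  · refine Finset.sum_congr rfl fun n _ => ?_
    rw [gOcc_eq_sum_piFinset, Finset.mul_sum]
    refine Finset.sum_congr rfl fun m hm => ?_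
    obtain ⟨hm', rfl⟩ := Finset.mem_filter.1 hm
    have hle : ∀ i, m i ≤ ξ i := fun i => by
      have h := Fintype.mem_piFinset.1 hm' i
      exact Nat.lt_succ_iff.1 (Finset.mem_range.1 h)
    rw [hprod, dirichletFunctional, momentFunctional_monomial, occWeight_eq_dirichletMoment hs,
      siteExponent, Finset.prod_mul_distrib, Finset.prod_mul_distrib, Finset.prod_pow_eq_pow_sum,
      Finset.prod_pow_eq_pow_sum, Finset.sum_tsub_distrib _ fun i _ => hle i]
    ring
  · intro m hm
    have hle : ∀ i, m i ≤ ξ i := fun i => by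
      have h := Fintype.mem_piFinset.1 hm i
      exact Nat.lt_succ_iff.1 (Finset.mem_range.1 h)
    exact Finset.mem_range.2 (Nat.lt_succ_of_le (Finset.sum_le_sum fun i _ => hle i))

/-! ### From occupation numbers to ordered positions -/

/-- The number of indices `a` with `y a = i`. -/
def occupation {N n : ℕ} (y : Fin n → Fin N) (i : Fin N) : ℕ :=
  (Finset.univ.filter fun a => y a = i).card

/-- An up-closed set of indices is a final segment, so its cardinality determines it. -/
lemma le_apply_iff_of_isUpperSet {n : ℕ} (p : Fin n → Prop) [DecidablePred p]
    (hp : ∀ a b, a ≤ b → p a → p b) (a : Fin n) :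
    p a ↔ n ≤ a.val + (Finset.univ.filter p).card := by
  constructor
  · intro ha
    have h : Finset.Ici a ⊆ Finset.univ.filter p := fun b hb =>
      Finset.mem_filter.2 ⟨Finset.mem_univ _, hp a b (Finset.mem_Ici.1 hb) ha⟩
    have := Finset.card_le_card h
    rw [Fin.card_Ici] at this
    omega
  · intro h
    by_contra ha
    have h2 : Finset.univ.filter p ⊆ Finset.Ioi a := fun b hb => by
      rw [Finset.mem_Ioi]
      by_contra hb2
      exact ha (hp b a (not_lt.1 hb2) (Finset.mem_filter.1 hb).2)
    have := Finset.card_le_card h2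
    rw [Fin.card_Ioi] at this
    omega

lemma prod_eq_occWeight {N n : ℕ} (s : ℝ) (y : Fin n → Fin N) (hy : Monotone y) :
    ∏ a : Fin n, ((n : ℝ) - ((a.val : ℝ) + 1) + 2 * s * ((N : ℝ) - ((y a).val : ℝ))) /
      ((n : ℝ) - ((a.val : ℝ) + 1) + 2 * s * ((N : ℝ) + 1)) = occWeight s (occupation y) := by
  rw [← Finset.prod_fiberwise Finset.univ y, occWeight]
  refine Finset.prod_congr rfl fun i _ => ?_
  set M := (Finset.univ.filter fun a => i ≤ y a).card with hM
  set M' := (Finset.univ.filter fun a => i < y a).card with hM'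
  have hMle : M ≤ n := (Finset.card_filter_le _ _).trans (by simp)
  have hMM : M = occupation y i + M' := by
    rw [hM, hM', occupation, ← Finset.card_union_of_disjoint]
    · congr 1
      ext a
      simp [le_iff_eq_or_lt, eq_comm]
    · rw [Finset.disjoint_filter]
      intro a _ h1 h2
      exact absurd h1.symm h2.ne
  have hsum : ∑ k ∈ Finset.Ici i, (occupation y k : ℝ) = M := by
    rw [← Nat.cast_sum, hM, Finset.card_eq_sum_card_fiberwise (f := y) (t := Finset.Ici i)]
    · congr 1
      refine Finset.sum_congr rfl fun k hk => ?_
      rw [occupation, Finset.filter_filter]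
      congr 1
      ext a
      simp only [Finset.mem_filter, Finset.mem_univ, true_and]
      exact ⟨fun h => ⟨h ▸ Finset.mem_Ici.1 hk, h⟩, fun h => h.2⟩
    · intro a ha
      simpa using ha
  have h1 : ∀ a : Fin n, i ≤ y a ↔ n ≤ a.val + M :=
    le_apply_iff_of_isUpperSet _ fun a b hab h => h.trans (hy hab)
  have h2 : ∀ a : Fin n, i < y a ↔ n ≤ a.val + M' :=
    le_apply_iff_of_isUpperSet _ fun a b hab h => h.trans_le (hy hab)
  have h3 : ∀ a : Fin n, y a = i ↔ n ≤ a.val + M ∧ a.val + M' < n := by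
    intro a
    rw [← h1, ← not_le, ← h2, not_lt, le_antisymm_iff, and_comm]
  -- The indices at site i form a block ending where the M' particles further right begin. Setting j
  -- = M + a + 1 - n gives n - (a + 1) = M - j, the shift appearing in `occWeight`.
  refine Finset.prod_nbij (fun a => M + a.val + 1 - n) ?_ ?_ ?_ ?_
  · intro a ha
    have := (h3 a).1 (Finset.mem_filter.1 ha).2
    simp only [Finset.mem_Icc]
    omega
  · intro a ha b hb hab
    have ha := (h3 a).1 (Finset.mem_filter.1 ha).2
    have hb := (h3 b).1 (Finset.mem_filter.1 hb).2
    ext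
    simp only at hab
    omega
  · intro j hj
    simp only [Finset.coe_Icc, Set.mem_Icc] at hj
    refine ⟨⟨n - M + j - 1, by omega⟩, ?_, ?_⟩
    · rw [Finset.mem_coe, Finset.mem_filter]
      refine ⟨Finset.mem_univ _, (h3 _).2 ?_⟩
      simp only
      omega
    · simp only
      omega
  · intro a ha
    have hya := (Finset.mem_filter.1 ha).2
    have := (h3 a).1 hya
    rw [hya, hsum, Nat.cast_sub (by omega)]
    push_cast
    congr 1 <;> ring

open Classical in
lemma gPos_eq_sum_powersetCard {N M : ℕ} (s : ℝ) (x : Fin M → Fin N) (hx : Monotone x) (n : ℕ) :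
    gPos s x n = ∑ S ∈ Finset.powersetCard n (Finset.univ : Finset (Fin M)),
      occWeight s fun i => (S.filter fun k => x k = i).card := by
  refine Finset.sum_nbij (fun e => Finset.univ.image e) ?_ ?_ ?_ ?_
  · intro e he
    have he := (Finset.mem_filter.1 he).2
    rw [Finset.mem_powersetCard]
    exact ⟨Finset.subset_univ _, by rw [Finset.card_image_of_injective _ he.injective]; simp⟩
  · intro e he e' he' h
    have he := (Finset.mem_filter.1 he).2
    have he' := (Finset.mem_filter.1 he').2
    refine (StrictMono.range_inj he he').1 ?_
    have := congrArg (fun S : Finset (Fin M) => (S : Set (Fin M))) h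
    simpa using this
  · intro S hS
    have hS := (Finset.mem_powersetCard.1 hS).2
    refine ⟨S.orderEmbOfFin hS, ?_, ?_⟩
    · rw [Finset.mem_coe, Finset.mem_filter]
      exact ⟨Finset.mem_univ _, (S.orderEmbOfFin hS).strictMono⟩
    · simp
  · intro e he
    have he := (Finset.mem_filter.1 he).2
    rw [prod_eq_occWeight s (fun a => x (e a)) (hx.comp he.monotone)]
    congr 1
    funext i
    rw [occupation, Finset.filter_image, Finset.card_image_of_injective _ he.injective]

/-- The weight of a set of particles depends only on its occupation numbers. Choosing particles one
by one or site by site is two expansions of one polynomial, ∏ (1 + X_{x_k}) = ∏ (1 + X_i)^{ξ_i}. -/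
lemma gPos_eq_gOcc {N M : ℕ} (s : ℝ) (ξ : Fin N → ℕ) (x : Fin M → Fin N) (hx : IsPositions ξ x)
    (n : ℕ) : gPos s x n = gOcc s ξ n := by
  classical
  have hcard : ∀ i, (Finset.univ.filter fun k => x k = i).card = ξ i := by
    intro i
    rw [← hx.2 i, Nat.card_eq_fintype_card, Fintype.card_subtype]
  have hpoly : ∏ k : Fin M, (MvPolynomial.X (x k) + 1 : MvPolynomial (Fin N) ℝ) =
      ∏ i, (MvPolynomial.X i + 1) ^ ξ i := by
    rw [← Finset.prod_fiberwise Finset.univ x]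
    refine Finset.prod_congr rfl fun i _ => ?_
    rw [← hcard i, ← Finset.prod_const]
    exact Finset.prod_congr rfl fun k hk => by rw [(Finset.mem_filter.1 hk).2]
  -- This functional keeps the monomials of degree n and weights them; applied to the two expansions
  -- it yields the two sums.
  set L := momentFunctional fun d : Fin N →₀ ℕ => if ∑ i, d i = n then occWeight s d else 0
  have h := congrArg L hpoly
  have hl : ∀ S : Finset (Fin M), L (∏ k ∈ S, MvPolynomial.X (x k)) =
      if S.card = n then occWeight s fun i => (S.filter fun k => x k = i).card else 0 := by
    intro S
    have e : ∀ i, (∑ k ∈ S, Finsupp.single (x k) 1 : Fin N →₀ ℕ) i =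
        (S.filter fun k => x k = i).card := by
      intro i
      rw [Finsupp.finsetSum_apply, Finset.card_filter]
      simp [Finsupp.single_apply]
    rw [show ∏ k ∈ S, (MvPolynomial.X (x k) : MvPolynomial (Fin N) ℝ) =
      MvPolynomial.monomial (∑ k ∈ S, Finsupp.single (x k) 1) 1 from
        (MvPolynomial.monomial_sum_one _ _).symm]
    rw [momentFunctional_monomial, one_mul, funext e,
      ← Finset.card_eq_sum_card_fiberwise (f := x) (t := Finset.univ) (by simp [Set.MapsTo])]
  have hr : ∀ i : Fin N, (MvPolynomial.X i + 1 : MvPolynomial (Fin N) ℝ) ^ ξ i =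
      ∑ k ∈ Finset.range (ξ i + 1), MvPolynomial.monomial (Finsupp.single i k)
        ((ξ i).choose k : ℝ) := by
    intro i
    rw [add_pow]
    refine Finset.sum_congr rfl fun k _ => ?_
    rw [one_pow, mul_one, MvPolynomial.X_pow_eq_monomial,
      ← map_natCast (MvPolynomial.C (R := ℝ) (σ := Fin N)), mul_comm, MvPolynomial.C_mul_monomial,
      mul_one]
  rw [gPos_eq_sum_powersetCard s x hx.1, gOcc_eq_sum_piFinset]
  rw [Finset.prod_add, map_sum, Finset.prod_congr rfl fun i _ => hr i, Finset.prod_univ_sum,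
    map_sum] at h
  simp only [Finset.prod_const_one, mul_one, hl, ← MvPolynomial.monomial_sum_prod,
    L, momentFunctional_monomial] at h
  rw [← Finset.sum_filter, ← Finset.powersetCard_eq_filter] at h
  rw [h, Finset.sum_filter]
  refine Finset.sum_congr rfl fun m _ => ?_
  have e : ∀ i, (∑ k, Finsupp.single k (m k) : Fin N →₀ ℕ) i = m i := by
    intro i
    rw [Finsupp.finsetSum_apply]
    simp [Finsupp.single_apply]
  rw [funext e]
  split_ifs <;> simp

/-! ### Beta and Gamma integrals in the generator -/

lemma integral_pow_mul_one_sub_rpow {y : ℝ} (hy : 0 < y) (n : ℕ) {p : ℝ} (hp : 0 < p) :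
    ∫ α in (0 : ℝ)..y, α ^ n * (1 - α / y) ^ (p - 1) = y ^ (n + 1) * betaWeight p (n + 1) := by
  suffices h : IntervalIntegrable (fun α => α ^ n * (1 - α / y) ^ (p - 1)) volume 0 y ∧
      ∫ α in (0 : ℝ)..y, α ^ n * (1 - α / y) ^ (p - 1) = y ^ (n + 1) * betaWeight p (n + 1) from h.2
  induction n generalizing p with
  | zero =>
    have h : ∫ α in (0 : ℝ)..y, (1 - α / y) ^ (p - 1) = y / p := by
      rw [intervalIntegral.integral_comp_sub_div (fun x => x ^ (p - 1)) hy.ne',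
        integral_rpow (Or.inl (by linarith)), div_self hy.ne']
      simp [hp.ne']
      ring
    refine ⟨?_, ?_⟩
    -- A non-integrable function has integral 0 by convention, so a positive value of the integral
    -- forces integrability.
    · by_contra hn
      have h2 := intervalIntegral.integral_undef hn
      simp only [pow_zero, one_mul] at h2
      rw [h2] at h
      exact (div_pos hy hp).ne h
    · simp [h, betaWeight, risingFac]
      ring
  | succ n ih =>
    have h : (fun α => α ^ (n + 1) * (1 - α / y) ^ (p - 1)) = fun α =>
        y * (α ^ n * (1 - α / y) ^ (p - 1) - α ^ n * (1 - α / y) ^ (p + 1 - 1)) := by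
      funext α
      obtain h0 | h0 := eq_or_ne (1 - α / y) 0
      · have hα : α = y := by field_simp at h0; linarith
        rw [h0, add_sub_cancel_right, Real.zero_rpow hp.ne', hα]
        ring
      · have : (1 - α / y) ^ (p + 1 - 1) = (1 - α / y) ^ (p - 1) * (1 - α / y) := by
          rw [← Real.rpow_add_one h0]
          congr 1
          ring
        rw [this]
        field_simp
        ring
    obtain ⟨i1, e1⟩ := ih hp
    obtain ⟨i2, e2⟩ := ih (show 0 < p + 1 by linarith)
    rw [h]
    refine ⟨(i1.sub i2).const_mul y, ?_⟩
    rw [intervalIntegral.integral_const_mul, intervalIntegral.integral_sub i1 i2, e1, e2]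
    have h1 := (risingFac_pos (show 0 < p + 1 by linarith) (n + 1)).ne'
    have h2 := (risingFac_pos (show 0 < p + 1 by linarith) n).ne'
    have h3 : p + 1 + n ≠ 0 := by positivity
    have e3 : ∀ m : ℕ, risingFac p (m + 1) = p * risingFac (p + 1) m := by
      intro m
      rw [add_comm, risingFac_add]
      simp [risingFac]
    simp only [betaWeight, if_neg (Nat.succ_ne_zero _), Nat.add_sub_cancel, e3, risingFac_succ,
      Nat.factorial_succ]
    push_cast
    field_simp
    ring

lemma intervalIntegrable_pow_mul_one_sub_rpow {y : ℝ} (hy : 0 < y) (n : ℕ) {p : ℝ} (hp : 0 < p) :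
    IntervalIntegrable (fun α => α ^ n * (1 - α / y) ^ (p - 1)) volume 0 y := by
  by_contra h
  have h1 := integral_pow_mul_one_sub_rpow hy n hp
  rw [intervalIntegral.integral_undef h, betaWeight, if_neg n.succ_ne_zero] at h1
  have := risingFac_pos hp (n + 1)
  have : 0 < y ^ (n + 1) * ((n + 1 - 1).factorial / risingFac p (n + 1)) := by positivity
  exact this.ne h1

lemma add_pow_eq_sum_antidiagonal_add (z α : ℝ) (b : ℕ) :
    (z + α) ^ b = (∑ p ∈ antidiagonal b,
      (if p.1 = 0 then 0 else b.choose p.1 * z ^ p.2) * (α * α ^ (p.1 - 1))) + z ^ b := by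
  rw [add_comm, (Commute.all α z).add_pow', ← sum_antidiagonal_ite_fst (fun m => z ^ m),
    ← Finset.sum_add_distrib]
  refine Finset.sum_congr rfl fun p _ => ?_
  split_ifs with h
  · simp [h]
  · rw [← pow_succ', Nat.sub_add_cancel (Nat.pos_of_ne_zero h), nsmul_eq_mul]
    ring

/-- The increment splits as (y - α)^a ((z + α)^b - z^b) + ((y - α)^a - y^a) z^b. Both parts are
divisible by α, which removes the singularity at 0 and leaves Beta integrals: with exponent c + a -
1 in the first, and with exponents c + j - 1 from a geometric sum in the second. -/
lemma integral_transfer {c y : ℝ} (hc : 0 < c) (hy : 0 < y) (z : ℝ) (a b : ℕ) :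
    ∫ α in (0 : ℝ)..y, (1 / α) * (1 - α / y) ^ (c - 1) *
        ((y - α) ^ a * (z + α) ^ b - y ^ a * z ^ b) =
      (∑ p ∈ antidiagonal b,
        b.choose p.1 * betaWeight (c + a) p.1 * y ^ (a + p.1) * z ^ p.2) -
        (∑ j ∈ Finset.range a, 1 / (c + j)) * (y ^ a * z ^ b) := by
  have hint : ∀ (n : ℕ) (j : ℕ), IntervalIntegrable
      (fun α => α ^ n * (1 - α / y) ^ (c + j - 1)) volume 0 y :=
    fun n j => intervalIntegrable_pow_mul_one_sub_rpow hy n (by positivity)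
  have hpt : ∀ α ∈ Set.Ioo 0 y, (1 / α) * (1 - α / y) ^ (c - 1) *
        ((y - α) ^ a * (z + α) ^ b - y ^ a * z ^ b) =
      (∑ p ∈ antidiagonal b, (if p.1 = 0 then 0 else b.choose p.1 * y ^ a * z ^ p.2) *
        (α ^ (p.1 - 1) * (1 - α / y) ^ (c + a - 1))) -
      ∑ j ∈ Finset.range a, (y ^ a * z ^ b / y) * (α ^ 0 * (1 - α / y) ^ (c + j - 1)) := by
    intro α hα
    have hα0 := hα.1.ne'
    have hpos : 0 < 1 - α / y := by
      rw [sub_pos, div_lt_one hy]; exact hα.2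
    set v := 1 - α / y with hv
    have hya : y - α = y * v := by rw [hv]; field_simp
    have hr : ∀ j : ℕ, v ^ (c + j - 1) = v ^ (c - 1) * v ^ j := by
      intro j
      rw [← Real.rpow_natCast, ← Real.rpow_add hpos]
      congr 1; ring
    have hgeo : v ^ a - 1 = -(α / y) * ∑ j ∈ Finset.range a, v ^ j := by
      rw [← mul_geom_sum, hv]
      ring
    rw [hya, mul_pow, add_pow_eq_sum_antidiagonal_add]
    simp only [hr, pow_zero, one_mul]
    have e1 : ∑ p ∈ antidiagonal b, (if p.1 = 0 then 0 else (b.choose p.1 : ℝ) * y ^ a * z ^ p.2) *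
        (α ^ (p.1 - 1) * (v ^ (c - 1) * v ^ a)) =
        (1 / α) * v ^ (c - 1) * (y ^ a * v ^ a) * ∑ p ∈ antidiagonal b,
        (if p.1 = 0 then 0 else b.choose p.1 * z ^ p.2) * (α * α ^ (p.1 - 1)) := by
      rw [Finset.mul_sum]
      refine Finset.sum_congr rfl fun p _ => ?_
      split_ifs
      · simp
      · field_simp
    have e2 : ∑ j ∈ Finset.range a, (y ^ a * z ^ b / y) * (v ^ (c - 1) * v ^ j) =
        - ((1 / α) * v ^ (c - 1) * y ^ a * z ^ b * (v ^ a - 1)) := by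
      rw [hgeo, ← Finset.mul_sum, ← Finset.mul_sum]
      field_simp
    rw [e1, e2]
    ring
  have hcongr : ∫ α in (0 : ℝ)..y, (1 / α) * (1 - α / y) ^ (c - 1) *
        ((y - α) ^ a * (z + α) ^ b - y ^ a * z ^ b) =
      ∫ α in (0 : ℝ)..y,
      ((∑ p ∈ antidiagonal b, (if p.1 = 0 then 0 else b.choose p.1 * y ^ a * z ^ p.2) *
        (α ^ (p.1 - 1) * (1 - α / y) ^ (c + a - 1))) -
      ∑ j ∈ Finset.range a, (y ^ a * z ^ b / y) * (α ^ 0 * (1 - α / y) ^ (c + j - 1))) :=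
    intervalIntegral.integral_congr_Ioo_of_le hy.le hpt
  rw [hcongr, intervalIntegral.integral_sub, intervalIntegral.integral_finsetSum,
    intervalIntegral.integral_finsetSum, Finset.sum_mul]
  · congr 1
    · refine Finset.sum_congr rfl fun p _ => ?_
      rw [intervalIntegral.integral_const_mul, integral_pow_mul_one_sub_rpow hy _ (by positivity)]
      split_ifs with h
      · simp [h, betaWeight]
      · rw [Nat.sub_add_cancel (Nat.pos_of_ne_zero h), pow_add]
        ring
    · refine Finset.sum_congr rfl fun j _ => ?_
      rw [intervalIntegral.integral_const_mul, integral_pow_mul_one_sub_rpow hy _ (by positivity)]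
      simp [betaWeight, risingFac]
      field_simp
  · exact fun j _ => (hint 0 j).const_mul _
  · exact fun p _ => (hint _ a).const_mul _
  · simpa only [Finset.sum_fn] using IntervalIntegrable.sum (antidiagonal b) fun p _ =>
      (hint (p.1 - 1) a).const_mul (if p.1 = 0 then 0 else b.choose p.1 * y ^ a * z ^ p.2)
  · simpa only [Finset.sum_fn] using IntervalIntegrable.sum (Finset.range a) fun j _ =>
      (hint 0 j).const_mul (y ^ a * z ^ b / y)

lemma integral_injection {lam : ℝ} (hlam : 0 < lam) (y : ℝ) (b : ℕ) :
    ∫ α in Set.Ioi (0 : ℝ), (1 / α) * Real.exp (-lam * α) * ((y + α) ^ b - y ^ b) =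
      ∑ p ∈ antidiagonal b, (if p.1 = 0 then 0 else
        b.choose p.1 * (p.1 - 1).factorial * (1 / lam) ^ p.1 * y ^ p.2) := by
  have hval : ∀ n : ℕ, ∫ α in Set.Ioi (0 : ℝ), α ^ n * Real.exp (-lam * α) =
      (1 / lam) ^ (n + 1) * n.factorial := by
    intro n
    have h := Real.integral_rpow_mul_exp_neg_mul_Ioi (show (0 : ℝ) < n + 1 by positivity) hlam
    rw [Real.Gamma_nat_eq_factorial] at h
    simp only [add_sub_cancel_right, Real.rpow_natCast] at h
    rw [← Nat.cast_add_one, Real.rpow_natCast] at h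
    simpa using h
  have hint : ∀ n : ℕ, IntegrableOn (fun α => α ^ n * Real.exp (-lam * α)) (Set.Ioi (0 : ℝ)) := by
    intro n
    by_contra h
    have h1 := hval n
    rw [integral_undef h] at h1
    have : 0 < (1 / lam) ^ (n + 1) * (n.factorial : ℝ) := by positivity
    exact this.ne h1
  have hpt : ∀ α ∈ Set.Ioi (0 : ℝ), (1 / α) * Real.exp (-lam * α) * ((y + α) ^ b - y ^ b) =
      ∑ p ∈ antidiagonal b, (if p.1 = 0 then 0 else b.choose p.1 * y ^ p.2) *
        (α ^ (p.1 - 1) * Real.exp (-lam * α)) := by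
    intro α hα
    have hα0 : α ≠ 0 := (Set.mem_Ioi.1 hα).ne'
    rw [add_pow_eq_sum_antidiagonal_add, add_sub_cancel_right, Finset.mul_sum]
    refine Finset.sum_congr rfl fun p _ => ?_
    field_simp
  rw [setIntegral_congr_fun measurableSet_Ioi hpt, integral_finsetSum]
  · refine Finset.sum_congr rfl fun p _ => ?_
    rw [integral_const_mul, hval]
    split_ifs with h
    · simp
    · rw [Nat.sub_add_cancel (Nat.pos_of_ne_zero h)]
      ring
  · exact fun p _ => (hint _).const_mul _

/-! ### Duality between energies and dual particles -/

lemma normMonomial_eq_prod {N : ℕ} {s : ℝ} (hs : 0 < s) (ξ : Fin N → ℕ) (y : Fin N → ℝ) :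
    normMonomial s ξ y = ∏ i, y i ^ ξ i / risingFac (2 * s) (ξ i) := by
  have hc : 0 < 2 * s := by positivity
  refine Finset.prod_congr rfl fun i _ => ?_
  have h1 := (Real.Gamma_pos_of_pos hc).ne'
  have h2 := (risingFac_pos hc (ξ i)).ne'
  rw [Gamma_add_nat hc]
  field_simp

/-- This is what the Gamma normalization is for: it turns the weights of the Beta integrals, which
depend on the occupation a of the target, into rates that depend only on the source. -/
lemma hopRate_mul_eq {c : ℝ} (hc : 0 < c) (a : ℕ) {k m b : ℕ} (hkm : k + m = b) :
    hopRate c k m * (1 / risingFac c (a + k) * (1 / risingFac c m)) =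
      b.choose k * betaWeight (c + a) k * (1 / risingFac c a * (1 / risingFac c b)) := by
  subst hkm
  obtain rfl | hk := eq_or_ne k 0
  · simp [betaWeight]
  obtain ⟨k, rfl⟩ := Nat.exists_eq_succ_of_ne_zero hk
  rw [hopRate, betaWeight, if_neg k.succ_ne_zero, Nat.cast_choose ℝ (Nat.le_add_right _ _),
    Nat.add_sub_cancel_left, risingFac_add c a, negBinomCoeff, negBinomCoeff]
  have h1 := (risingFac_pos hc a).ne'
  have h2 := (risingFac_pos hc m).ne'
  have h3 := (risingFac_pos hc (k.succ + m)).ne'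
  have h4 := (risingFac_pos (show 0 < c + a by positivity) k.succ).ne'
  simp only [Nat.succ_eq_add_one, Nat.add_sub_cancel, Nat.factorial_succ k] at *
  push_cast
  field_simp

lemma prod_eq_mul_mul_prod_erase_erase {N : ℕ} (f : Fin N → ℝ) {i j : Fin N} (hij : i ≠ j) :
    ∏ l, f l = f i * (f j * ∏ l ∈ (Finset.univ.erase i).erase j, f l) := by
  rw [Finset.mul_prod_erase _ f (Finset.mem_erase.2 ⟨hij.symm, Finset.mem_univ j⟩),
    Finset.mul_prod_erase _ f (Finset.mem_univ i)]

/-- The rate at which particles leave a site of occupation `a` in a given direction. -/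
def escapeRate (c : ℝ) (a : ℕ) : ℝ := ∑ j ∈ Finset.range a, 1 / (c + j)

/-- Duality for the transfer from site `i` to site `j`. -/
lemma transferGen_normMonomial {N : ℕ} {s : ℝ} (hs : 0 < s) (ξ : Fin N → ℕ) {i j : Fin N}
    (hij : i ≠ j) {y : Fin N → ℝ} (hy : 0 < y i) :
    transferGen s i j (normMonomial s ξ) y =
      (∑ p ∈ antidiagonal (ξ j), hopRate (2 * s) p.1 p.2 *
        normMonomial s (Function.update ξ j p.2 + Pi.single i p.1) y) -
      escapeRate (2 * s) (ξ i) * normMonomial s ξ y := by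
  have hc : 0 < 2 * s := by positivity
  set K := ∏ l ∈ (Finset.univ.erase i).erase j, y l ^ ξ l / risingFac (2 * s) (ξ l) with hK
  set A := 1 / risingFac (2 * s) (ξ i) * (1 / risingFac (2 * s) (ξ j)) with hA
  have h1 : ∀ α, normMonomial s ξ (y - Pi.single i α + Pi.single j α) =
      K * A * ((y i - α) ^ ξ i * (y j + α) ^ ξ j) := by
    intro α
    rw [normMonomial_eq_prod hs, prod_eq_mul_mul_prod_erase_erase _ hij]
    have : ∏ l ∈ (Finset.univ.erase i).erase j,
        (y - Pi.single i α + Pi.single j α : Fin N → ℝ) l ^ ξ l / risingFac (2 * s) (ξ l) = K := by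
      refine Finset.prod_congr rfl fun l hl => ?_
      simp only [Finset.mem_erase] at hl
      simp [Pi.single_eq_of_ne hl.1, Pi.single_eq_of_ne hl.2.1]
    rw [this]
    simp [Pi.single_eq_of_ne hij, Pi.single_eq_of_ne hij.symm, hA]
    ring
  have h0 : normMonomial s ξ y = K * A * (y i ^ ξ i * y j ^ ξ j) := by
    have := h1 0
    simpa using this
  -- Dual particles move against the energy: energy going from i to j corresponds to particles going
  -- from j to i.
  have h2 : ∀ p ∈ antidiagonal (ξ j), hopRate (2 * s) p.1 p.2 *
        normMonomial s (Function.update ξ j p.2 + Pi.single i p.1) y =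
      K * A * ((ξ j).choose p.1 * betaWeight (2 * s + ξ i) p.1 * y i ^ (ξ i + p.1) *
        y j ^ p.2) := by
    intro p hp
    have key := hopRate_mul_eq hc (ξ i) (Finset.HasAntidiagonal.mem_antidiagonal.1 hp)
    rw [normMonomial_eq_prod hs, prod_eq_mul_mul_prod_erase_erase _ hij]
    have : ∏ l ∈ (Finset.univ.erase i).erase j,
        y l ^ (Function.update ξ j p.2 + Pi.single i p.1 : Fin N → ℕ) l /
          risingFac (2 * s) ((Function.update ξ j p.2 + Pi.single i p.1 : Fin N → ℕ) l) = K := by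
      refine Finset.prod_congr rfl fun l hl => ?_
      simp only [Finset.mem_erase] at hl
      simp [Pi.single_eq_of_ne hl.2.1, Function.update_of_ne hl.1]
    rw [this]
    simp only [Pi.add_apply, Function.update_of_ne hij, Pi.single_eq_same, Function.update_self,
      Pi.single_eq_of_ne hij.symm, add_zero]
    rw [← hA] at key
    linear_combination (K * y i ^ (ξ i + p.1) * y j ^ p.2) * key
  rw [transferGen, Finset.sum_congr rfl h2, ← Finset.mul_sum, h0, escapeRate]
  simp only [h1]
  have h3 := integral_transfer hc hy (y j) (ξ i) (ξ j)
  have h4 : ∀ α, 1 / α * (1 - α / y i) ^ (2 * s - 1) *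
      (K * A * ((y i - α) ^ ξ i * (y j + α) ^ ξ j) - K * A * (y i ^ ξ i * y j ^ ξ j)) =
      K * A * (1 / α * (1 - α / y i) ^ (2 * s - 1) *
        ((y i - α) ^ ξ i * (y j + α) ^ ξ j - y i ^ ξ i * y j ^ ξ j)) := fun α => by ring
  simp only [h4]
  rw [intervalIntegral.integral_const_mul, h3]
  ring

/-- Duality for a reservoir. -/
lemma reservoirGen_normMonomial {N : ℕ} {s lam : ℝ} (hs : 0 < s) (hlam : 0 < lam) (ξ : Fin N → ℕ)
    (i : Fin N) {y : Fin N → ℝ} (hy : 0 < y i) :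
    reservoirGen s lam i (normMonomial s ξ) y =
      (∑ p ∈ antidiagonal (ξ i), hopRate (2 * s) p.1 p.2 *
        ((1 / lam) ^ p.1 * normMonomial s (Function.update ξ i p.2) y)) -
      escapeRate (2 * s) (ξ i) * normMonomial s ξ y := by
  have hc : 0 < 2 * s := by positivity
  set K := ∏ l ∈ Finset.univ.erase i, y l ^ ξ l / risingFac (2 * s) (ξ l) with hK
  set A := 1 / risingFac (2 * s) (ξ i) with hA
  have h1 : ∀ w : Fin N → ℝ, (∀ l, l ≠ i → w l = y l) →
      normMonomial s ξ w = K * A * w i ^ ξ i := by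
    intro w hw
    rw [normMonomial_eq_prod hs, ← Finset.mul_prod_erase _ _ (Finset.mem_univ i),
      Finset.prod_congr rfl fun l hl => by rw [hw l (Finset.ne_of_mem_erase hl)]]
    simp only [hK, hA]
    ring
  have h0 : normMonomial s ξ y = K * A * y i ^ ξ i := h1 y fun _ _ => rfl
  have hsub : ∀ α, normMonomial s ξ (y - Pi.single i α) = K * A * (y i - α) ^ ξ i := by
    intro α
    rw [h1 _ fun l hl => by simp [Pi.single_eq_of_ne hl]]
    simp
  have hadd : ∀ α, normMonomial s ξ (y + Pi.single i α) = K * A * (y i + α) ^ ξ i := by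
    intro α
    rw [h1 _ fun l hl => by simp [Pi.single_eq_of_ne hl]]
    simp
  have h2 : ∀ p ∈ antidiagonal (ξ i), hopRate (2 * s) p.1 p.2 *
        ((1 / lam) ^ p.1 * normMonomial s (Function.update ξ i p.2) y) =
      K * A * (if p.1 = 0 then 0 else
        (ξ i).choose p.1 * (p.1 - 1).factorial * (1 / lam) ^ p.1 * y i ^ p.2) := by
    intro p hp
    have key := hopRate_mul_eq hc 0 (Finset.HasAntidiagonal.mem_antidiagonal.1 hp)
    rw [normMonomial_eq_prod hs, ← Finset.mul_prod_erase _ _ (Finset.mem_univ i),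
      Function.update_self, Finset.prod_congr rfl fun l hl => by
        rw [Function.update_of_ne (Finset.ne_of_mem_erase hl)], ← hK]
    split_ifs with h
    · simp [h]
    · rw [betaWeight, if_neg h] at key
      have h5 := (risingFac_pos hc p.1).ne'
      simp only [zero_add, Nat.cast_zero, add_zero, risingFac_zero, div_one, one_mul, ← hA] at key
      have key2 : hopRate (2 * s) p.1 p.2 * (1 / risingFac (2 * s) p.2) =
          (ξ i).choose p.1 * (p.1 - 1).factorial * A := by
        field_simp at key ⊢
        linear_combination key
      linear_combination (K * (1 / lam) ^ p.1 * y i ^ p.2) * key2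
  rw [reservoirGen, Finset.sum_congr rfl h2, ← Finset.mul_sum, h0, escapeRate]
  simp only [hsub, hadd]
  -- Removal by the reservoir is a transfer to a site whose power is trivial.
  have h3 := integral_transfer hc hy 0 (ξ i) 0
  have h4 : ∀ t α, t * (K * A * (y i - α) ^ ξ i - K * A * y i ^ ξ i) =
      K * A * (t * ((y i - α) ^ ξ i - y i ^ ξ i)) := fun t α => by ring
  have h5 : ∀ t α, t * (K * A * (y i + α) ^ ξ i - K * A * y i ^ ξ i) =
      K * A * (t * ((y i + α) ^ ξ i - y i ^ ξ i)) := fun t α => by ring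
  simp only [pow_zero, mul_one] at h3
  simp only [h4, h5]
  rw [intervalIntegral.integral_const_mul, integral_const_mul, h3, integral_injection hlam]
  simp [betaWeight]
  ring

/-- Duality between the energy process and the absorbed particle system. -/
theorem generator_normMonomial {N : ℕ} [NeZero N] {s lamL lamR : ℝ} (hs : 0 < s) (hL : 0 < lamL)
    (hR : 0 < lamR) (ξ : Fin N → ℕ) {y : Fin N → ℝ} (hy : ∀ i, 0 < y i) :
    generator s lamL lamR (normMonomial s ξ) y =
      dualGen (2 * s) (1 / lamL) (1 / lamR) (fun η => normMonomial s η y) ξ := by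
  obtain ⟨n, rfl⟩ := Nat.exists_eq_succ_of_ne_zero (NeZero.ne N)
  set u : (Fin (n + 1) → ℕ) → ℝ := fun η => normMonomial s η y with hu
  set RG : Fin (n + 1) → ℝ := fun i => ∑ p ∈ antidiagonal (ξ i), hopRate (2 * s) p.1 p.2 *
    jumpRight (1 / lamR) u ξ i p.1 p.2 with hRG
  set LG : Fin (n + 1) → ℝ := fun i => ∑ p ∈ antidiagonal (ξ i), hopRate (2 * s) p.1 p.2 *
    jumpLeft (1 / lamL) u ξ i p.1 p.2 with hLG
  set H : Fin (n + 1) → ℝ := fun i => escapeRate (2 * s) (ξ i) * u ξ with hH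
  have hd : dualGen (2 * s) (1 / lamL) (1 / lamR) u ξ = ∑ i, (RG i + LG i - 2 * H i) := by
    refine Finset.sum_congr rfl fun i _ => ?_
    simp only [hRG, hLG, hH, escapeRate, ← sum_hopRate (show 0 < 2 * s by positivity)]
    rw [← Finset.sum_add_distrib, Finset.sum_mul, Finset.mul_sum, ← Finset.sum_sub_distrib]
    exact Finset.sum_congr rfl fun p _ => by ring
  have h0 : reservoirGen s lamL 0 (normMonomial s ξ) y = LG 0 - H 0 := by
    rw [reservoirGen_normMonomial hs hL ξ 0 (hy 0)]
    simp [hLG, hH, hu, jumpLeft]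
  have hlast : reservoirGen s lamR ⊤ (normMonomial s ξ) y = RG (Fin.last n) - H (Fin.last n) := by
    rw [reservoirGen_normMonomial hs hR ξ ⊤ (hy _), Fin.top_eq_last]
    simp [hRG, hH, hu, jumpRight]
  -- A single transfer pairs the gain of hops from one site with the loss rate of the other. Only
  -- the sum over all bonds and both reservoirs assigns every site two losses and one gain in each
  -- direction.
  have hr : ∀ k : Fin n, transferGen s k.succ k.castSucc (normMonomial s ξ) y =
      RG k.castSucc - H k.succ := by
    intro k
    rw [transferGen_normMonomial hs ξ k.castSucc_lt_succ.ne' (hy _)]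
    simp [hRG, hH, hu, jumpRight]
    rfl
  have hl : ∀ k : Fin n, transferGen s k.castSucc k.succ (normMonomial s ξ) y =
      LG k.succ - H k.castSucc := by
    intro k
    rw [transferGen_normMonomial hs ξ k.castSucc_lt_succ.ne (hy _)]
    simp [hLG, hH, hu, jumpLeft]
    rfl
  have hb : ∀ k : Fin n, (if h : k.castSucc.val + 1 < n + 1 then
      bondGen s k.castSucc ⟨k.castSucc.val + 1, h⟩ (normMonomial s ξ) y else 0) =
      LG k.succ - H k.castSucc + (RG k.castSucc - H k.succ) := by
    intro k
    rw [dif_pos (by simp), ← hr, ← hl]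
    rfl
  rw [hd, generator, h0, hlast, Fin.sum_univ_castSucc, Finset.sum_congr rfl fun k _ => hb k,
    dif_neg (by simp)]
  simp only [Finset.sum_add_distrib, Finset.sum_sub_distrib, ← Finset.mul_sum]
  rw [Fin.sum_univ_castSucc RG, Fin.sum_univ_succ LG, two_mul, Fin.sum_univ_succ H]
  have := Fin.sum_univ_castSucc H
  rw [Fin.sum_univ_succ H] at this
  linear_combination this

/-! ### Lyapunov function and exponential decay of the dual equation -/

/-- A strictly concave profile vanishing at the two absorbing sites. -/
def concaveProfile {N : ℕ} (i : Fin N) : ℝ := (i.val + 1) * (N - i.val)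

lemma concaveProfile_pos {N : ℕ} (i : Fin N) : 0 < concaveProfile i := by
  have : (i.val : ℝ) < N := by exact_mod_cast i.isLt
  exact mul_pos (by positivity) (by linarith)

/-- A Lyapunov function for the dual particle system. -/
def lyapunov {N : ℕ} (R : ℝ) (ξ : Fin N → ℕ) : ℝ :=
  R ^ (∑ i, ξ i) * ∑ i, (ξ i : ℝ) * concaveProfile i

lemma lyapunov_pos {N : ℕ} {R : ℝ} (hR : 0 < R) {ξ : Fin N → ℕ} (hξ : ξ ≠ 0) :
    0 < lyapunov R ξ := by
  obtain ⟨i, hi⟩ := Function.ne_iff.1 hξ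
  have hi : 0 < ξ i := Nat.pos_of_ne_zero hi
  refine mul_pos (by positivity) (Finset.sum_pos' (fun j _ => ?_) ⟨i, Finset.mem_univ i, ?_⟩)
  · exact mul_nonneg (Nat.cast_nonneg _) (concaveProfile_pos j).le
  · exact mul_pos (by exact_mod_cast hi) (concaveProfile_pos i)

lemma sum_update_mul {N : ℕ} (g : Fin N → ℝ) (ξ : Fin N → ℕ) (i : Fin N) (m : ℕ) :
    ∑ l, (Function.update ξ i m l : ℝ) * g l = ∑ l, (ξ l : ℝ) * g l + (m - ξ i) * g i := by
  rw [← Finset.add_sum_erase _ _ (Finset.mem_univ i),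
    ← Finset.add_sum_erase _ (fun l => (ξ l : ℝ) * g l) (Finset.mem_univ i), Function.update_self,
    Finset.sum_congr rfl fun l hl => by rw [Function.update_of_ne (Finset.ne_of_mem_erase hl)]]
  ring

lemma sum_single_mul {N : ℕ} (g : Fin N → ℝ) (j : Fin N) (k : ℕ) :
    ∑ l, ((Pi.single j k : Fin N → ℕ) l : ℝ) * g l = k * g j := by
  rw [Finset.sum_eq_single j]
  · simp
  · intro l _ hl
    simp [Pi.single_eq_of_ne hl]
  · simp

lemma sum_update_add {N : ℕ} {ξ : Fin N → ℕ} {i : Fin N} {k m : ℕ} (h : k + m = ξ i) :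
    ∑ l, Function.update ξ i m l + k = ∑ l, ξ l := by
  rw [← Finset.add_sum_erase _ _ (Finset.mem_univ i),
    ← Finset.add_sum_erase _ (fun l => ξ l) (Finset.mem_univ i), Function.update_self,
    Finset.sum_congr rfl fun l hl => by rw [Function.update_of_ne (Finset.ne_of_mem_erase hl)]]
  have : (Finset.univ.erase i).sum ξ = ∑ l ∈ Finset.univ.erase i, ξ l := rfl
  omega

lemma sum_update_add_single {N : ℕ} {ξ : Fin N → ℕ} {i j : Fin N} {k m : ℕ} (h : k + m = ξ i) :
    ∑ l, (Function.update ξ i m + Pi.single j k : Fin N → ℕ) l = ∑ l, ξ l := by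
  simp only [Pi.add_apply, Finset.sum_add_distrib]
  rw [← sum_update_add h]
  simp

lemma lyapunov_update_add_single {N : ℕ} (R : ℝ) {ξ : Fin N → ℕ} {i j : Fin N} {k m : ℕ}
    (h : k + m = ξ i) : lyapunov R (Function.update ξ i m + Pi.single j k) =
      lyapunov R ξ + R ^ (∑ l, ξ l) * (k * (concaveProfile j - concaveProfile i)) := by
  rw [lyapunov, sum_update_add_single h, lyapunov]
  simp only [Pi.add_apply, Nat.cast_add, add_mul, Finset.sum_add_distrib]
  rw [sum_update_mul, sum_single_mul, ← h]
  push_cast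
  ring

/-- The factor R to the number of particles is there for this: the weight T^k ≤ R^k of absorbed
particles is offset by the lost powers of R, so absorption acts like moving to a site of profile 0.
-/
lemma pow_mul_lyapunov_update_le {N : ℕ} {R T : ℝ} (hT : 0 ≤ T) (hTR : T ≤ R) {ξ : Fin N → ℕ}
    {i : Fin N} {k m : ℕ} (h : k + m = ξ i) : T ^ k * lyapunov R (Function.update ξ i m) ≤
      lyapunov R ξ - R ^ (∑ l, ξ l) * (k * concaveProfile i) := by
  have h1 : 0 ≤ lyapunov R (Function.update ξ i m) :=
    mul_nonneg (pow_nonneg (hT.trans hTR) _) (Finset.sum_nonneg fun l _ =>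
      mul_nonneg (Nat.cast_nonneg _) (concaveProfile_pos l).le)
  refine (mul_le_mul_of_nonneg_right (pow_le_pow_left₀ hT hTR k) h1).trans_eq ?_
  rw [lyapunov, ← mul_assoc, ← pow_add, add_comm k, sum_update_add h, sum_update_mul, lyapunov, ← h]
  push_cast
  ring

lemma jumpRight_lyapunov_le {N : ℕ} {R T : ℝ} (hT : 0 ≤ T) (hTR : T ≤ R) {ξ : Fin N → ℕ}
    {i : Fin N} {k m : ℕ} (h : k + m = ξ i) : jumpRight T (lyapunov R) ξ i k m ≤
      lyapunov R ξ + R ^ (∑ l, ξ l) * (k * (N - 2 * (i.val + 1))) := by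
  rw [jumpRight]
  split_ifs with hi
  · rw [lyapunov_update_add_single R h]
    refine le_of_eq ?_
    simp only [concaveProfile]
    push_cast
    ring
  · refine (pow_mul_lyapunov_update_le hT hTR h).trans_eq ?_
    have : (i.val : ℝ) = N - 1 := by
      have h2 : ((i.val + 1 : ℕ) : ℝ) = N := congrArg Nat.cast (by omega)
      rw [← h2]; push_cast; ring
    simp only [concaveProfile, this]
    ring

lemma jumpLeft_lyapunov_le {N : ℕ} {R T : ℝ} (hT : 0 ≤ T) (hTR : T ≤ R) {ξ : Fin N → ℕ}
    {i : Fin N} {k m : ℕ} (h : k + m = ξ i) : jumpLeft T (lyapunov R) ξ i k m ≤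
      lyapunov R ξ + R ^ (∑ l, ξ l) * (k * (2 * i.val - N)) := by
  rw [jumpLeft]
  split_ifs with hi
  · rw [lyapunov_update_add_single R h]
    refine le_of_eq ?_
    simp only [concaveProfile]
    rw [Nat.cast_sub hi]
    push_cast
    ring
  · refine (pow_mul_lyapunov_update_le hT hTR h).trans_eq ?_
    have : i.val = 0 := by omega
    simp only [concaveProfile, this]
    push_cast
    ring

/-- The profile has second difference -2, including at the ends, so a right and a left hop of k
particles together lower the function by at least 2k times a power of R. -/
lemma dualGen_lyapunov_neg {N : ℕ} {c R TL TR : ℝ} (hc : 0 < c) (hL : 0 ≤ TL) (hR : 0 ≤ TR)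
    (hR0 : 0 < R) (hLR : TL ≤ R) (hRR : TR ≤ R) {ξ : Fin N → ℕ} (hξ : ξ ≠ 0) :
    dualGen c TL TR (lyapunov R) ξ < 0 := by
  have hterm : ∀ i, ∀ p ∈ antidiagonal (ξ i), hopRate c p.1 p.2 *
      (jumpRight TR (lyapunov R) ξ i p.1 p.2 + jumpLeft TL (lyapunov R) ξ i p.1 p.2 -
        2 * lyapunov R ξ) ≤ -(2 * R ^ (∑ l, ξ l) * (hopRate c p.1 p.2 * p.1)) := by
    intro i p hp
    have hp := Finset.HasAntidiagonal.mem_antidiagonal.1 hp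
    have h1 := jumpRight_lyapunov_le hR hRR hp
    have h2 := jumpLeft_lyapunov_le hL hLR hp
    refine (mul_le_mul_of_nonneg_left (c := -(2 * R ^ (∑ l, ξ l) * p.1)) ?_
      (hopRate_nonneg hc p.1 p.2)).trans_eq (by ring)
    linear_combination h1 + h2
  have hsum : 0 < ∑ i, ∑ p ∈ antidiagonal (ξ i), hopRate c p.1 p.2 * p.1 := by
    have hnn : ∀ i, ∀ p ∈ antidiagonal (ξ i), 0 ≤ hopRate c p.1 p.2 * p.1 :=
      fun i p _ => mul_nonneg (hopRate_nonneg hc _ _) (Nat.cast_nonneg _)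
    obtain ⟨i, hi⟩ := Function.ne_iff.1 hξ
    refine Finset.sum_pos' (fun i _ => Finset.sum_nonneg (hnn i)) ⟨i, Finset.mem_univ i, ?_⟩
    refine Finset.sum_pos' (hnn i) ⟨(ξ i, 0), by simp, ?_⟩
    have hi : 0 < ξ i := Nat.pos_of_ne_zero hi
    exact mul_pos (hopRate_pos hc hi.ne' 0) (by exact_mod_cast hi)
  calc dualGen c TL TR (lyapunov R) ξ
      ≤ ∑ i, ∑ p ∈ antidiagonal (ξ i), -(2 * R ^ (∑ l, ξ l) * (hopRate c p.1 p.2 * p.1)) :=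
        Finset.sum_le_sum fun i _ => Finset.sum_le_sum (hterm i)
    _ = -(2 * R ^ (∑ l, ξ l) * ∑ i, ∑ p ∈ antidiagonal (ξ i), hopRate c p.1 p.2 * p.1) := by
        simp only [Finset.sum_neg_distrib, Finset.mul_sum]
    _ < 0 := by
        rw [neg_lt_zero]
        positivity

/-- Half of the total jump rate out of a configuration. -/
def totalRate {N : ℕ} (c : ℝ) (ξ : Fin N → ℕ) : ℝ :=
  ∑ i, ∑ p ∈ antidiagonal (ξ i), hopRate c p.1 p.2

lemma totalRate_nonneg {N : ℕ} {c : ℝ} (hc : 0 < c) (ξ : Fin N → ℕ) : 0 ≤ totalRate c ξ :=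
  Finset.sum_nonneg fun _ _ => Finset.sum_nonneg fun p _ => hopRate_nonneg hc p.1 p.2

lemma mul_add_dualGen {N : ℕ} (c TL TR Λ : ℝ) (u : (Fin N → ℕ) → ℝ) (ξ : Fin N → ℕ) :
    Λ * u ξ + dualGen c TL TR u ξ = (Λ - 2 * totalRate c ξ) * u ξ +
      ∑ i, ∑ p ∈ antidiagonal (ξ i), hopRate c p.1 p.2 *
        (jumpRight TR u ξ i p.1 p.2 + jumpLeft TL u ξ i p.1 p.2) := by
  simp only [dualGen, totalRate, mul_sub, Finset.sum_sub_distrib, ← Finset.sum_mul]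
  ring

/-- Comparison principle for the dual generator. -/
lemma abs_mul_add_dualGen_le {N : ℕ} {c TL TR Λ M : ℝ} (hc : 0 < c) (hL : 0 ≤ TL) (hR : 0 ≤ TR)
    {u h : (Fin N → ℕ) → ℝ} {ξ : Fin N → ℕ} (hΛ : 2 * totalRate c ξ ≤ Λ)
    (hu : ∀ η : Fin N → ℕ, ∑ i, η i ≤ ∑ i, ξ i → |u η| ≤ M * h η) :
    |Λ * u ξ + dualGen c TL TR u ξ| ≤ M * (Λ * h ξ + dualGen c TL TR h ξ) := by
  have hupd : ∀ i k m, k + m = ξ i → ∑ l, Function.update ξ i m l ≤ ∑ l, ξ l := by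
    intro i k m hkm
    rw [← sum_update_add hkm]
    exact Nat.le_add_right _ _
  have hjr : ∀ i k m, k + m = ξ i → |jumpRight TR u ξ i k m| ≤ M * jumpRight TR h ξ i k m := by
    intro i k m hkm
    simp only [jumpRight]
    split_ifs
    · exact hu _ (sum_update_add_single hkm).le
    · rw [abs_mul, abs_of_nonneg (pow_nonneg hR k), mul_left_comm]
      exact mul_le_mul_of_nonneg_left (hu _ (hupd i k m hkm)) (pow_nonneg hR k)
  have hjl : ∀ i k m, k + m = ξ i → |jumpLeft TL u ξ i k m| ≤ M * jumpLeft TL h ξ i k m := by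
    intro i k m hkm
    simp only [jumpLeft]
    split_ifs
    · exact hu _ (sum_update_add_single hkm).le
    · rw [abs_mul, abs_of_nonneg (pow_nonneg hL k), mul_left_comm]
      exact mul_le_mul_of_nonneg_left (hu _ (hupd i k m hkm)) (pow_nonneg hL k)
  rw [mul_add_dualGen, mul_add_dualGen, mul_add]
  refine (abs_add_le _ _).trans (add_le_add ?_ ?_)
  · rw [abs_mul, abs_of_nonneg (sub_nonneg.2 hΛ), mul_left_comm]
    exact mul_le_mul_of_nonneg_left (hu ξ le_rfl) (sub_nonneg.2 hΛ)
  · rw [Finset.mul_sum]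
    refine (Finset.abs_sum_le_sum_abs _ _).trans (Finset.sum_le_sum fun i _ => ?_)
    rw [Finset.mul_sum]
    refine (Finset.abs_sum_le_sum_abs _ _).trans (Finset.sum_le_sum fun p hp => ?_)
    have hp := Finset.HasAntidiagonal.mem_antidiagonal.1 hp
    rw [abs_mul, abs_of_nonneg (hopRate_nonneg hc _ _), mul_left_comm]
    refine mul_le_mul_of_nonneg_left ((abs_add_le _ _).trans ?_) (hopRate_nonneg hc _ _)
    rw [mul_add]
    exact add_le_add (hjr i _ _ hp) (hjl i _ _ hp)

/-- The nonempty configurations with at most `d` particles. -/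
def configsUpTo (N d : ℕ) : Finset (Fin N → ℕ) :=
  (Fintype.piFinset fun _ => Finset.range (d + 1)).filter fun η => η ≠ 0 ∧ ∑ i, η i ≤ d

lemma mem_configsUpTo {N d : ℕ} {η : Fin N → ℕ} :
    η ∈ configsUpTo N d ↔ η ≠ 0 ∧ ∑ i, η i ≤ d := by
  simp only [configsUpTo, Finset.mem_filter, Fintype.mem_piFinset, Finset.mem_range,
    and_iff_right_iff_imp]
  intro h i
  exact Nat.lt_succ_of_le ((Finset.single_le_sum (f := η) (fun _ _ => Nat.zero_le _)
    (Finset.mem_univ i)).trans h.2)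

/-- Solutions of the dual Kolmogorov equation vanishing at the empty configuration decay
exponentially, uniformly in the initial value. -/
theorem exists_exponential_decay (N : ℕ) {c TL TR : ℝ} (hc : 0 < c) (hL : 0 < TL) (hR : 0 < TR)
    (d : ℕ) : ∃ h : (Fin N → ℕ) → ℝ, ∃ ε > 0, (∀ η, η ≠ 0 → 0 < h η) ∧
      ∀ u : ℝ → (Fin N → ℕ) → ℝ,
        (∀ ξ, ∀ t, 0 ≤ t →
          HasDerivWithinAt (fun r => u r ξ) (dualGen c TL TR (u t) ξ) (Set.Ici 0) t) →
        (∀ t, 0 ≤ t → u t 0 = 0) →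
        ∀ ξ ∈ configsUpTo N d, ∀ t, 0 ≤ t →
          |u t ξ| ≤ h ξ * Real.exp (-ε * t) * ∑ η ∈ configsUpTo N d, |u 0 η| / h η := by
  set R := max TL TR
  have hR0 : 0 < R := hL.trans_le (le_max_left _ _)
  set h : (Fin N → ℕ) → ℝ := lyapunov R with hh
  have hpos : ∀ η, η ≠ 0 → 0 < h η := fun η hη => lyapunov_pos hR0 hη
  have hneg : ∀ η, η ≠ 0 → dualGen c TL TR h η < 0 := fun η hη =>
    dualGen_lyapunov_neg hc hL.le hR.le hR0 (le_max_left _ _) (le_max_right _ _) hη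
  have hzero : h 0 = 0 := by simp [hh, lyapunov]
  obtain ⟨ε, hε, hεle⟩ : ∃ ε > 0, ∀ η ∈ configsUpTo N d, dualGen c TL TR h η ≤ -ε * h η := by
    obtain he | hne := (configsUpTo N d).eq_empty_or_nonempty
    · exact ⟨1, one_pos, by simp [he]⟩
    · obtain ⟨η₀, hη₀, hmin⟩ := Finset.exists_min_image (configsUpTo N d)
        (fun η => -dualGen c TL TR h η / h η) hne
      have h0 := (mem_configsUpTo.1 hη₀).1
      refine ⟨_, div_pos (neg_pos.2 (hneg η₀ h0)) (hpos η₀ h0), fun η hη => ?_⟩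
      have h1 := hmin η hη
      rw [le_div_iff₀ (hpos η (mem_configsUpTo.1 hη).1)] at h1
      linarith
  -- Any common bound on the total jump rates serves; it makes Λ + `dualGen` a positive operator.
  set Λ := ∑ η ∈ configsUpTo N d, 2 * totalRate c η with hΛ
  have hΛle : ∀ η ∈ configsUpTo N d, 2 * totalRate c η ≤ Λ := fun η hη =>
    Finset.single_le_sum (f := fun η => 2 * totalRate c η)
      (fun η _ => mul_nonneg two_pos.le (totalRate_nonneg hc η)) hη
  refine ⟨h, ε, hε, hpos, fun u hu hu0 ξ hξ t ht => ?_⟩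
  -- In the sup norm weighted by 1/h, positivity and the Lyapunov inequality bound the derivative by
  -- (Λ - ε) times the norm. Grönwall's inequality applies, and undoing the factor exp(Λ r) leaves
  -- decay at rate ε.
  let v : ℝ → (configsUpTo N d → ℝ) := fun r η => Real.exp (Λ * r) * u r η / h η
  let v' : ℝ → (configsUpTo N d → ℝ) := fun r η =>
    Real.exp (Λ * r) * (Λ * u r η + dualGen c TL TR (u r) η) / h η
  have hv : ∀ r, 0 ≤ r → HasDerivWithinAt v (v' r) (Set.Ici 0) r := by
    intro r hr
    rw [hasDerivWithinAt_pi]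
    intro η
    have h1 : HasDerivWithinAt (fun r : ℝ => Real.exp (Λ * r)) (Real.exp (Λ * r) * Λ)
        (Set.Ici 0) r := by
      simpa using (((hasDerivAt_id r).const_mul Λ).exp).hasDerivWithinAt
    refine ((h1.mul (hu η r hr)).div_const (h η)).congr_deriv ?_
    simp only [v']
    ring
  have hbound : ∀ r, 0 ≤ r → ∀ η : Fin N → ℕ, ∑ i, η i ≤ d →
      |u r η| ≤ (Real.exp (-(Λ * r)) * ‖v r‖) * h η := by
    intro r hr η hη
    obtain rfl | h0 := eq_or_ne η 0
    · rw [hu0 r hr, hzero]; simp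
    · have h1 := norm_le_pi_norm (v r) ⟨η, mem_configsUpTo.2 ⟨h0, hη⟩⟩
      have h2 := hpos η h0
      simp only [v, Real.norm_eq_abs, abs_div, abs_mul, abs_of_pos h2, Real.abs_exp] at h1
      rw [div_le_iff₀ h2] at h1
      have h3 : |u r η| = Real.exp (-(Λ * r)) * (Real.exp (Λ * r) * |u r η|) := by
        rw [← mul_assoc, ← Real.exp_add]; simp
      rw [h3, mul_assoc]
      exact mul_le_mul_of_nonneg_left h1 (Real.exp_pos _).le
  have hv'le : ∀ r, 0 ≤ r → ‖v' r‖ ≤ (Λ - ε) * ‖v r‖ + 0 := by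
    intro r hr
    have key : ∀ η : configsUpTo N d, |v' r η| ≤ (Λ - ε) * ‖v r‖ := by
      intro η
      obtain ⟨h0, hη⟩ := mem_configsUpTo.1 η.2
      have h1 := abs_mul_add_dualGen_le hc hL.le hR.le (hΛle η η.2)
        fun η' hη' => hbound r hr η' (hη'.trans hη)
      have h2 := hpos η h0
      have h3 : Λ * h η + dualGen c TL TR h η ≤ (Λ - ε) * h η := by
        have := hεle η η.2
        linarith
      have h4 := h1.trans (mul_le_mul_of_nonneg_left h3 (by positivity))
      simp only [v', abs_div, abs_mul, abs_of_pos h2, Real.abs_exp]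
      rw [div_le_iff₀ h2]
      refine (mul_le_mul_of_nonneg_left h4 (Real.exp_pos _).le).trans_eq ?_
      have h5 : Real.exp (Λ * r) * Real.exp (-(Λ * r)) = 1 := by rw [← Real.exp_add]; simp
      linear_combination (‖v r‖ * ((Λ - ε) * h η)) * h5
    rw [add_zero]
    -- The sign of Λ - ε need not be examined: the index set contains ξ, and the bound there forces
    -- the right side to be nonnegative.
    have hnn : 0 ≤ (Λ - ε) * ‖v r‖ := (abs_nonneg _).trans (key ⟨ξ, hξ⟩)
    rw [pi_norm_le_iff_of_nonneg hnn]
    exact key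
  have hgr := norm_le_gronwallBound_of_norm_deriv_right_le (f := v) (f' := v') (δ := ‖v 0‖)
    (K := Λ - ε) (ε := 0) (a := 0) (b := t)
    (fun r hr => ((hv r hr.1).continuousWithinAt).mono Set.Icc_subset_Ici_self)
    (fun r hr => (hv r hr.1).mono (Set.Ici_subset_Ici.2 hr.1)) le_rfl
    (fun r hr => hv'le r hr.1) t ⟨ht, le_rfl⟩
  rw [gronwallBound_ε0, sub_zero] at hgr
  have hv0 : ‖v 0‖ ≤ ∑ η ∈ configsUpTo N d, |u 0 η| / h η := by
    have hnn : ∀ η ∈ configsUpTo N d, 0 ≤ |u 0 η| / h η := fun η hη =>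
      div_nonneg (abs_nonneg _) (hpos η (mem_configsUpTo.1 hη).1).le
    rw [pi_norm_le_iff_of_nonneg (Finset.sum_nonneg hnn)]
    intro η
    have h2 := hpos η (mem_configsUpTo.1 η.2).1
    simp only [v, Real.norm_eq_abs, mul_zero, Real.exp_zero, one_mul, abs_div, abs_of_pos h2]
    exact Finset.single_le_sum (f := fun η => |u 0 η| / h η) hnn η.2
  have hξd := mem_configsUpTo.1 hξ
  have h2 := hpos ξ hξd.1
  calc |u t ξ| ≤ (Real.exp (-(Λ * t)) * ‖v t‖) * h ξ := hbound t ht ξ hξd.2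
    _ ≤ (Real.exp (-(Λ * t)) * ((∑ η ∈ configsUpTo N d, |u 0 η| / h η) *
          Real.exp ((Λ - ε) * t))) * h ξ := by
        gcongr
        exact hgr.trans (mul_le_mul_of_nonneg_right hv0 (Real.exp_pos _).le)
    _ = h ξ * Real.exp (-ε * t) * ∑ η ∈ configsUpTo N d, |u 0 η| / h η := by
        rw [show -ε * t = -(Λ * t) + (Λ - ε) * t by ring, Real.exp_add]
        ring

/-! ### Convergence of expectations and the stationary moments -/

open Filter Topology

lemma dualGen_sub {N : ℕ} (c TL TR : ℝ) (u v : (Fin N → ℕ) → ℝ) (ξ : Fin N → ℕ) :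
    dualGen c TL TR (fun η => u η - v η) ξ = dualGen c TL TR u ξ - dualGen c TL TR v ξ := by
  have hr : ∀ i k m, jumpRight TR (fun η => u η - v η) ξ i k m =
      jumpRight TR u ξ i k m - jumpRight TR v ξ i k m := by
    intro i k m
    simp only [jumpRight]
    split_ifs <;> ring
  have hl : ∀ i k m, jumpLeft TL (fun η => u η - v η) ξ i k m =
      jumpLeft TL u ξ i k m - jumpLeft TL v ξ i k m := by
    intro i k m
    simp only [jumpLeft]
    split_ifs <;> ring
  simp only [dualGen, ← Finset.sum_sub_distrib, hr, hl]
  exact Finset.sum_congr rfl fun i _ => Finset.sum_congr rfl fun p _ => by ring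

lemma integral_dualGen {Ω : Type*} [MeasurableSpace Ω] {ν : Measure Ω} {N : ℕ} (c TL TR : ℝ)
    (f : (Fin N → ℕ) → Ω → ℝ) (hf : ∀ η, Integrable (f η) ν) (ξ : Fin N → ℕ) :
    ∫ z, dualGen c TL TR (fun η => f η z) ξ ∂ν = dualGen c TL TR (fun η => ∫ z, f η z ∂ν) ξ := by
  have hr : ∀ i k m, Integrable (fun z => jumpRight TR (fun η => f η z) ξ i k m) ν ∧
      ∫ z, jumpRight TR (fun η => f η z) ξ i k m ∂ν =
        jumpRight TR (fun η => ∫ z, f η z ∂ν) ξ i k m := by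
    intro i k m
    simp only [jumpRight]
    split_ifs
    · exact ⟨hf _, rfl⟩
    · exact ⟨(hf _).const_mul _, integral_const_mul _ _⟩
  have hl : ∀ i k m, Integrable (fun z => jumpLeft TL (fun η => f η z) ξ i k m) ν ∧
      ∫ z, jumpLeft TL (fun η => f η z) ξ i k m ∂ν =
        jumpLeft TL (fun η => ∫ z, f η z ∂ν) ξ i k m := by
    intro i k m
    simp only [jumpLeft]
    split_ifs
    · exact ⟨hf _, rfl⟩
    · exact ⟨(hf _).const_mul _, integral_const_mul _ _⟩
  have hi : ∀ i, ∀ p : ℕ × ℕ, Integrable (fun z => hopRate c p.1 p.2 *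
      (jumpRight TR (fun η => f η z) ξ i p.1 p.2 + jumpLeft TL (fun η => f η z) ξ i p.1 p.2 -
        2 * f ξ z)) ν := fun i p =>
    (((hr i p.1 p.2).1.add (hl i p.1 p.2).1).sub ((hf ξ).const_mul 2)).const_mul _
  simp only [dualGen]
  rw [integral_finsetSum _ fun i _ => integrable_finsetSum _ fun p _ => hi i p]
  refine Finset.sum_congr rfl fun i _ => ?_
  rw [integral_finsetSum _ fun p _ => hi i p]
  refine Finset.sum_congr rfl fun p _ => ?_
  have h1 : Integrable (fun z => jumpRight TR (fun η => f η z) ξ i p.1 p.2 +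
      jumpLeft TL (fun η => f η z) ξ i p.1 p.2) ν := (hr i p.1 p.2).1.add (hl i p.1 p.2).1
  rw [integral_const_mul, integral_sub h1 ((hf ξ).const_mul 2), integral_add (hr i p.1 p.2).1 (hl i p.1 p.2).1, (hr i p.1 p.2).2,
    (hl i p.1 p.2).2, integral_const_mul]

/-- The normalized monomial as a polynomial. -/
def normMonomialPoly {N : ℕ} (s : ℝ) (ξ : Fin N → ℕ) : MvPolynomial (Fin N) ℝ :=
  MvPolynomial.monomial (Finsupp.equivFunOnFinite.symm ξ)
    (∏ i, Real.Gamma (2 * s) / Real.Gamma (2 * s + ξ i))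

lemma eval_normMonomialPoly {N : ℕ} (s : ℝ) (ξ : Fin N → ℕ) (y : Fin N → ℝ) :
    MvPolynomial.eval y (normMonomialPoly s ξ) = normMonomial s ξ y := by
  rw [normMonomialPoly, MvPolynomial.eval_monomial, normMonomial, Finset.prod_mul_distrib, mul_comm,
    Finsupp.prod_fintype _ _ fun i => pow_zero _]
  rfl

lemma normMonomial_nonneg {N : ℕ} {s : ℝ} (hs : 0 < s) (ξ : Fin N → ℕ) (y : State N) :
    0 ≤ normMonomial s ξ y.1 := by
  rw [normMonomial_eq_prod hs]
  exact Finset.prod_nonneg fun i _ =>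
    div_nonneg (pow_nonneg (y.2 i).le _) (risingFac_pos (by positivity) _).le

lemma measurable_normMonomial {N : ℕ} (s : ℝ) (ξ : Fin N → ℕ) :
    Measurable fun y : State N => normMonomial s ξ y.1 := by
  refine Finset.measurable_prod _ fun i _ => Measurable.mul_const (Measurable.pow_const ?_ _) _
  exact (measurable_pi_apply i).comp measurable_subtype_coe

section Semigroup

variable {N : ℕ} [NeZero N] {s lamL lamR : ℝ} {P : ℝ≥0 → Kernel (State N) (State N)}

lemma IsProcessSemigroup.integrable_normMonomial (hP : IsProcessSemigroup s lamL lamR P)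
    (ξ : Fin N → ℕ) (t : ℝ≥0) (y : State N) :
    Integrable (fun z : State N => normMonomial s ξ z.1) (P t y) := by
  simpa only [eval_normMonomialPoly] using hP.integrable (normMonomialPoly s ξ) t y

lemma IsProcessSemigroup.hasDerivWithinAt_normMonomial (hP : IsProcessSemigroup s lamL lamR P)
    (hs : 0 < s) (hL : 0 < lamL) (hR : 0 < lamR) (ξ : Fin N → ℕ) (y : State N) {t : ℝ}
    (ht : 0 ≤ t) :
    HasDerivWithinAt (fun r : ℝ => ∫ z : State N, normMonomial s ξ z.1 ∂(P r.toNNReal y))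
      (dualGen (2 * s) (1 / lamL) (1 / lamR)
        (fun η => ∫ z : State N, normMonomial s η z.1 ∂(P t.toNNReal y)) ξ) (Set.Ici 0) t := by
  have h := hP.hasDeriv (normMonomialPoly s ξ) t.toNNReal y
  simp only [eval_normMonomialPoly, Real.coe_toNNReal t ht] at h
  rw [← integral_dualGen _ _ _ (fun η (z : State N) => normMonomial s η z.1)
    fun η => hP.integrable_normMonomial η _ y]
  convert h using 1
  exact integral_congr_ae (Eventually.of_forall fun z =>
    (generator_normMonomial hs hL hR ξ z.2).symm)

/-- Expectations of normalized monomials converge exponentially fast, with a constant that is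
integrable as soon as the monomials of at most the same degree are. -/
lemma IsProcessSemigroup.exists_abs_integral_sub_le (hP : IsProcessSemigroup s lamL lamR P)
    (hs : 0 < s) (hL : 0 < lamL) (hR : 0 < lamR) {ξ : Fin N → ℕ} (hξ : ξ ≠ 0) :
    ∃ (S : Finset (Fin N → ℕ)) (a : (Fin N → ℕ) → ℝ) (ε : ℝ), 0 < ε ∧ ∀ (y : State N) (t : ℝ≥0),
      |∫ z : State N, normMonomial s ξ z.1 ∂(P t y) -
          steadyMoment (2 * s) (1 / lamL) (1 / lamR) ξ| ≤
        Real.exp (-ε * t) * ∑ η ∈ S, a η *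
          |normMonomial s η y.1 - steadyMoment (2 * s) (1 / lamL) (1 / lamR) η| := by
  have hc : 0 < 2 * s := by positivity
  obtain ⟨h, ε, hε, hpos, hdecay⟩ := exists_exponential_decay N hc (one_div_pos.2 hL)
    (one_div_pos.2 hR) (∑ i, ξ i)
  set G : (Fin N → ℕ) → ℝ := steadyMoment (2 * s) (1 / lamL) (1 / lamR) with hG
  refine ⟨configsUpTo N (∑ i, ξ i), fun η => h ξ / h η, ε, hε, fun y t => ?_⟩
  -- The difference solves the dual equation because G is harmonic, and it vanishes at the empty
  -- configuration because both terms equal 1 there.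
  have := hdecay (fun r η => ∫ z : State N, normMonomial s η z.1 ∂(P r.toNNReal y) - G η)
    (fun η r hr => by
      rw [dualGen_sub, hG, dualGen_steadyMoment hc, sub_zero]
      exact (hP.hasDerivWithinAt_normMonomial hs hL hR η y hr).sub_const _)
    (fun r _ => by
      have := hP.markov r.toNNReal
      simp [normMonomial, hG, steadyMoment_zero, (Real.Gamma_pos_of_pos hc).ne'])
    ξ (mem_configsUpTo.2 ⟨hξ, le_rfl⟩) t t.2
  simp only [Real.toNNReal_coe, Real.toNNReal_zero, hP.zero, Kernel.id_apply] at this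
  refine this.trans_eq ?_
  rw [mul_comm (h ξ), mul_assoc, Finset.mul_sum]
  congr 1
  refine Finset.sum_congr rfl fun η _ => ?_
  rw [integral_dirac' _ _ (measurable_normMonomial s η).stronglyMeasurable]
  ring

lemma IsProcessSemigroup.tendsto_integral_normMonomial (hP : IsProcessSemigroup s lamL lamR P)
    (hs : 0 < s) (hL : 0 < lamL) (hR : 0 < lamR) {ξ : Fin N → ℕ} (hξ : ξ ≠ 0) (y : State N) :
    Tendsto (fun n : ℕ => ∫ z : State N, normMonomial s ξ z.1 ∂(P n y)) atTop
      (𝓝 (steadyMoment (2 * s) (1 / lamL) (1 / lamR) ξ)) := by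
  obtain ⟨S, a, ε, hε, h⟩ := hP.exists_abs_integral_sub_le hs hL hR hξ
  rw [tendsto_iff_norm_sub_tendsto_zero]
  have hexp : Tendsto (fun n : ℕ => Real.exp (-ε * n)) atTop (𝓝 0) := by
    refine Real.tendsto_exp_atBot.comp ?_
    exact tendsto_natCast_atTop_atTop.const_mul_atTop_of_neg (neg_lt_zero.2 hε)
  have h2 := hexp.mul_const (∑ η ∈ S, a η *
    |normMonomial s η y.1 - steadyMoment (2 * s) (1 / lamL) (1 / lamR) η|)
  rw [zero_mul] at h2
  exact squeeze_zero (fun _ => norm_nonneg _) (fun n => by simpa using h y n) h2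

/-- Truncate at K. By invariance, the truncated integral is at most the integral of min(P_n f, K),
which tends to min(G, K) ≤ G by dominated convergence. The bound is uniform in K, so monotone
convergence gives a finite integral. -/
lemma IsStationary.integrable_normMonomial {μ : Measure (State N)} (hμ : IsStationary P μ)
    (hP : IsProcessSemigroup s lamL lamR P) (hs : 0 < s) (hL : 0 < lamL) (hR : 0 < lamR)
    (ξ : Fin N → ℕ) : Integrable (fun y : State N => normMonomial s ξ y.1) μ := by
  have := hμ.isProbabilityMeasure
  obtain rfl | hξ := eq_or_ne ξ 0
  · simp [normMonomial]
  set G := steadyMoment (2 * s) (1 / lamL) (1 / lamR) ξ with hG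
  set f : State N → ENNReal := fun y => ENNReal.ofReal (normMonomial s ξ y.1) with hf
  have hfm : Measurable f := (measurable_normMonomial s ξ).ennreal_ofReal
  have htr : ∀ K : ℕ, ∫⁻ y, min (f y) K ∂μ ≤ ENNReal.ofReal G := by
    intro K
    have hK : Measurable fun y => min (f y) (K : ENNReal) := hfm.min measurable_const
    have hle : ∀ n : ℕ, ∫⁻ y, min (f y) K ∂μ ≤ ∫⁻ y, min (∫⁻ z, f z ∂(P n y)) K ∂μ := by
      intro n
      have := hP.markov n
      nth_rw 1 [← (hμ.invariant n).def]
      rw [Measure.lintegral_bind (P n).measurable.aemeasurable hK.aemeasurable]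
      refine lintegral_mono fun y => le_min (lintegral_mono fun z => min_le_left _ _) ?_
      refine (lintegral_mono fun z => min_le_right _ _).trans ?_
      simp
    have hlim : Tendsto (fun n : ℕ => ∫⁻ y, min (∫⁻ z, f z ∂(P n y)) K ∂μ) atTop
        (𝓝 (∫⁻ _, min (ENNReal.ofReal G) K ∂μ)) := by
      refine tendsto_lintegral_of_dominated_convergence (fun _ => (K : ENNReal))
        (fun n => (hfm.lintegral_kernel).min measurable_const)
        (fun n => Eventually.of_forall fun y => min_le_right _ _) (by simp)
        (Eventually.of_forall fun y => ?_)
      have h1 := ENNReal.tendsto_ofReal (hP.tendsto_integral_normMonomial hs hL hR hξ y)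
      have h2 : ∀ n : ℕ, ENNReal.ofReal (∫ z : State N, normMonomial s ξ z.1 ∂(P n y)) =
          ∫⁻ z, f z ∂(P n y) := fun n =>
        ofReal_integral_eq_lintegral_ofReal (hP.integrable_normMonomial ξ n y)
          (Eventually.of_forall fun z => normMonomial_nonneg hs ξ z)
      simp only [h2] at h1
      exact h1.min tendsto_const_nhds
    refine (ge_of_tendsto' hlim hle).trans ?_
    simp
  have hmono : Tendsto (fun K : ℕ => ∫⁻ y, min (f y) K ∂μ) atTop (𝓝 (∫⁻ y, f y ∂μ)) := by
    refine lintegral_tendsto_of_tendsto_of_monotone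
      (fun K => (hfm.min measurable_const).aemeasurable)
      (Eventually.of_forall fun y K K' hKK => min_le_min_left _ (by exact_mod_cast hKK))
      (Eventually.of_forall fun y => ?_)
    obtain ⟨K, hK⟩ := ENNReal.exists_nat_gt (ENNReal.ofReal_ne_top : f y ≠ ⊤)
    refine tendsto_const_nhds.congr' ?_
    filter_upwards [eventually_ge_atTop K] with K' hK'
    exact (min_eq_left (hK.le.trans (by exact_mod_cast hK'))).symm
  have hfin : ∫⁻ y, f y ∂μ < ⊤ := (le_of_tendsto' hmono htr).trans_lt ENNReal.ofReal_lt_top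
  refine ⟨(measurable_normMonomial s ξ).aestronglyMeasurable, ?_⟩
  rw [hasFiniteIntegral_iff_ofReal
    (Eventually.of_forall fun z => normMonomial_nonneg hs ξ z)]
  exact hfin

/-- By invariance the moment is the μ-average of E_y at any time n, and the exponential bound has a
μ-integrable prefactor once all moments are finite. Letting n tend to infinity leaves no error. -/
theorem IsStationary.integral_normMonomial {μ : Measure (State N)} (hμ : IsStationary P μ)
    (hP : IsProcessSemigroup s lamL lamR P) (hs : 0 < s) (hL : 0 < lamL) (hR : 0 < lamR)
    (ξ : Fin N → ℕ) : ∫ y : State N, normMonomial s ξ y.1 ∂μ =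
      steadyMoment (2 * s) (1 / lamL) (1 / lamR) ξ := by
  have := hμ.isProbabilityMeasure
  obtain rfl | hξ := eq_or_ne ξ 0
  · simp [normMonomial, steadyMoment_zero,
      (Real.Gamma_pos_of_pos (show 0 < 2 * s by positivity)).ne']
  set G : (Fin N → ℕ) → ℝ := steadyMoment (2 * s) (1 / lamL) (1 / lamR) with hG
  obtain ⟨S, a, ε, hε, h⟩ := hP.exists_abs_integral_sub_le hs hL hR hξ
  set g : State N → ℝ := fun y => ∑ η ∈ S, a η * |normMonomial s η y.1 - G η| with hg
  have hgi : Integrable g μ := integrable_finsetSum _ fun η _ =>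
    (((hμ.integrable_normMonomial hP hs hL hR η).sub (integrable_const _)).abs).const_mul _
  have key : ∀ n : ℕ, |∫ y : State N, normMonomial s ξ y.1 ∂μ - G ξ| ≤
      Real.exp (-ε * n) * ∫ y, g y ∂μ := by
    intro n
    have := hP.markov n
    have hcomp : (P n ∘ₖ Kernel.const Unit μ) () = μ := by
      rw [Kernel.comp_apply, Kernel.const_apply, (hμ.invariant n).def]
    have hint : Integrable (fun y : State N => normMonomial s ξ y.1)
        ((P n ∘ₖ Kernel.const Unit μ) ()) := by
      rw [hcomp]; exact hμ.integrable_normMonomial hP hs hL hR ξ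
    have h1 : ∫ y : State N, normMonomial s ξ y.1 ∂μ =
        ∫ y, ∫ z : State N, normMonomial s ξ z.1 ∂(P n y) ∂μ := by
      have := Kernel.integral_comp hint
      rwa [hcomp, Kernel.const_apply] at this
    have h2 := hint.integral_comp
    rw [Kernel.const_apply] at h2
    have h3 : ∫ y : State N, normMonomial s ξ y.1 ∂μ - G ξ =
        ∫ y, (∫ z : State N, normMonomial s ξ z.1 ∂(P n y) - G ξ) ∂μ := by
      rw [integral_sub h2 (integrable_const _), ← h1]
      simp
    rw [h3, ← Real.norm_eq_abs, ← integral_const_mul]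
    exact norm_integral_le_of_norm_le (hgi.const_mul _) (Eventually.of_forall fun y => h y n)
  have hexp : Tendsto (fun n : ℕ => Real.exp (-ε * n)) atTop (𝓝 0) :=
    Real.tendsto_exp_atBot.comp
      (tendsto_natCast_atTop_atTop.const_mul_atTop_of_neg (neg_lt_zero.2 hε))
  have h2 := hexp.mul_const (∫ y, g y ∂μ)
  rw [zero_mul] at h2
  exact sub_eq_zero.1 (abs_nonpos_iff.1 (ge_of_tendsto' h2 key))

end Semigroup

end HeatConduction

end

theorem theorem2 (N : ℕ) [NeZero N] (s lamL lamR TL TR : ℝ)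
    (hs : 0 < s) (hL : 0 < lamL) (hR : 0 < lamR)
    (hTL : TL = 1 / lamL) (hTR : TR = 1 / lamR)
    (P : NNReal → ProbabilityTheory.Kernel (HeatConduction.State N) (HeatConduction.State N))
    (hP : HeatConduction.IsProcessSemigroup s lamL lamR P)
    (μ : MeasureTheory.Measure (HeatConduction.State N))
    (hμ : HeatConduction.IsStationary P μ) (ξ : Fin N → ℕ) :
    MeasureTheory.Integrable
        (fun y : HeatConduction.State N => HeatConduction.normMonomial s ξ y.1) μ ∧
      ∫ y : HeatConduction.State N, HeatConduction.normMonomial s ξ y.1 ∂μ =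
        ∑ n ∈ Finset.range ((∑ i, ξ i) + 1),
          TR ^ ((∑ i, ξ i) - n) * (TL - TR) ^ n * HeatConduction.gOcc s ξ n ∧
      ∀ x : Fin (∑ i, ξ i) → Fin N, HeatConduction.IsPositions ξ x →
        (∫ y : HeatConduction.State N, HeatConduction.normMonomial s ξ y.1 ∂μ =
          ∑ n ∈ Finset.range ((∑ i, ξ i) + 1),
            TR ^ ((∑ i, ξ i) - n) * (TL - TR) ^ n * HeatConduction.gPos s x n) ∧
        ∀ n : ℕ, HeatConduction.gPos s x n = HeatConduction.gOcc s ξ n := by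
  subst hTL hTR
  have hmoment : ∫ y : HeatConduction.State N, HeatConduction.normMonomial s ξ y.1 ∂μ =
      ∑ n ∈ Finset.range ((∑ i, ξ i) + 1),
        (1 / lamR) ^ ((∑ i, ξ i) - n) * (1 / lamL - 1 / lamR) ^ n *
          HeatConduction.gOcc s ξ n := by
    rw [hμ.integral_normMonomial hP hs hL hR ξ, HeatConduction.steadyMoment_eq_sum_gOcc hs]
  refine ⟨hμ.integrable_normMonomial hP hs hL hR ξ, hmoment, fun x hx => ?_⟩
  have hg : ∀ n, HeatConduction.gPos s x n = HeatConduction.gOcc s ξ n :=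
    HeatConduction.gPos_eq_gOcc s ξ x hx
  exact ⟨by simp only [hg, hmoment], hg⟩
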